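/- Let $0<\alpha<1$ and $\alpha+\theta>0$. Let $(\Pi_n)_{n\ge 1}$ be the Ewens–Pitman random partitions with parameters $(\alpha,\theta)$ on a probability space: $\Pi_n$ is a random partition of $\{1,\dots,n\}$ and, for every $n\ge1$, given that $\Pi_n$ is a partition with $k$ blocks $A_1,\dots,A_k$, the partition $\Pi_{n+1}$ is obtained by attaching $n+1$ to the block $A_i$ with probability $(|A_i|-\alpha)/(n+\theta)$, $1\le i\le k$, or by adding the new block $\{n+1\}$ with probability $(\alpha k+\theta)/(n+\theta)$. Let $K_n$ be the number of blocks of $\Pi_n$, $K_{r,n}$ the number of its blocks of size $r$, and $\mathcal F_{r,n}=\sigma(K_j,K_{1,j},\dots,K_{r,j}:1\le j\le n)$. Write $(x)^{(n)}=x(x+1)\cdots(x+n-1)$ and, for $1\le i\le r$, $$p_\alpha(r)=\frac{\alpha(1-\alpha)^{(r-1)}}{r!},\qquad b_{r,i}=(-1)^{r-i}\frac{(i-\alpha)^{(r-i)}}{(r-i)!}.$$ For a sequence of weights $a=(a_n)_{n\ge1}$ put $$M^{a}_{r,n}=a_n\Bigl(\sum_{i=1}^r b_{r,i}K_{i,n}+(-1)^rp_\alpha(r)K_n+(-1)^rp_\alpha(r)\frac{\theta}{\alpha}\Bigr).$$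 For a square-integrable martingale $(M_n)_{n\ge s}$ with respect to $(\mathcal F_n)_{n\ge s}$, let $\langle M\rangle_n=\sum_{k=s}^{n-1}\mathbb E[(M_{k+1}-M_k)^2\mid\mathcal F_k]$ be its predictable quadratic variation. Then there is a random variable $S_{\alpha,\theta}$, almost surely positive and finite, such that $K_n/n^\alpha\to S_{\alpha,\theta}$ almost surely, and for every $r\ge1$ the following hold. (1) Assume that $\alpha+\theta\notin\{1,\dots,r-1\}$, and let $a_{r,n}=\dfrac{(\theta+1)^{(n-1)}}{(\alpha+\theta-r+1)^{(n-1)}}$ for $n\ge1$. Then $M_{r,n}=M^{a_r}_{r,n}$, $n\ge1$, is a martingale with respect to $(\mathcal F_{r,n})_{n\ge1}$ with $\mathbb E[M_{r,n}^2]<\infty$ for all $n$ (in particular, a locally square-integrable martingale), and $$\lim_{n\to\infty}\frac{\langle M_r\rangle_n}{n^{2r-\alpha}}=p_\alpha(r)\,\frac{(r-\alpha)^{(r)}}{r!}\left(\frac{\Gamma(\alpha+\theta-r+1)}{\Gamma(\theta+1)}\right)^2S_{\alpha,\theta}\qquad\text{almost surely.}$$ (2) Without any restriction on $\alpha+\theta>0$,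 let $\tilde a_{r,n}=1$ for $n\le r$ and $\tilde a_{r,n}=\prod_{k=r}^{n-1}\dfrac{k+\theta}{k+\alpha+\theta-r}$ for $n\ge r+1$. Then $\widetilde M_{r,n}=M^{\tilde a_r}_{r,n}$, $n\ge r$, is a martingale with respect to $(\mathcal F_{r,n})_{n\ge r}$ with $\mathbb E[\widetilde M_{r,n}^2]<\infty$ for all $n\ge r$, and $$\lim_{n\to\infty}\frac{\langle \widetilde M_r\rangle_n}{n^{2r-\alpha}}=p_\alpha(r)\,\frac{(r-\alpha)^{(r)}}{r!}\left(\frac{\Gamma(\alpha+\theta)}{\Gamma(\theta+r)}\right)^2S_{\alpha,\theta}\qquad\text{almost surely.}$$ -/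

import Mathlib

open MeasureTheory ProbabilityTheory Filter Topology

noncomputable section

namespace EwensPitman

/-- The rising factorial `x (x + 1) ⋯ (x + n - 1)`. -/
def rising (x : ℝ) (n : ℕ) : ℝ := (ascPochhammer ℝ n).eval x

/-- The Sibuya weights `p_α(r) = α (1 - α)^{(r-1)} / r!`, for `r ≥ 1`. -/
def sibuya (α : ℝ) (r : ℕ) : ℝ := α * rising (1 - α) (r - 1) / (r.factorial : ℝ)

/-- The coefficients `b_{r,i} = (-1)^{r-i} (i - α)^{(r-i)} / (r-i)!`, for `1 ≤ i ≤ r`. -/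
def coeffB (α : ℝ) (r i : ℕ) : ℝ :=
  (-1) ^ (r - i) * rising ((i : ℝ) - α) (r - i) / ((r - i).factorial : ℝ)

/-- The weights `(θ + 1)^{(n-1)} / (α + θ - r + 1)^{(n-1)}`, for `n ≥ 1`. -/
def weight (α θ : ℝ) (r n : ℕ) : ℝ :=
  rising (θ + 1) (n - 1) / rising (α + θ - (r : ℝ) + 1) (n - 1)

/-- The weights equal to `1` for `n ≤ r` and to
`∏_{k = r}^{n-1} (k + θ) / (k + α + θ - r)` for `n ≥ r + 1`. -/
def truncWeight (α θ : ℝ) (r n : ℕ) : ℝ :=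
  ∏ k ∈ Finset.Ico r n, ((k : ℝ) + θ) / ((k : ℝ) + α + θ - (r : ℝ))

section Partitions

variable {Ω : Type*} {mΩ : MeasurableSpace Ω}

/-- The sequential construction of the Ewens-Pitman random partitions: `P n` is a random partition
of `{1, …, n}` and, for every `n ≥ 1`, given that `P n = π`, where `π` has `k` blocks, the element
`n + 1` is attached to a block `A` of `π` with probability `(#A - α) / (n + θ)`, and forms a new
block with probability `(α k + θ) / (n + θ)`. These probabilities sum to `1`, hence `P (n + 1)`
almost surely determines `P 1, …, P n`, and conditioning on `P n` is conditioning on the past. -/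
structure IsEwensPitmanProcess (μ : Measure Ω) (α θ : ℝ)
    (P : (n : ℕ) → Ω → Finpartition (Finset.Icc 1 n)) : Prop where
  measurableSet_eq : ∀ (n : ℕ) (π : Finpartition (Finset.Icc 1 n)),
    MeasurableSet {ω | P n ω = π}
  prob_attach : ∀ n : ℕ, 1 ≤ n → ∀ π : Finpartition (Finset.Icc 1 n), ∀ A ∈ π.parts,
    μ.real {ω | P n ω = π ∧ (P (n + 1) ω).parts = insert (insert (n + 1) A) (π.parts.erase A)}
      = μ.real {ω | P n ω = π} * (((A.card : ℝ) - α) / ((n : ℝ) + θ))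
  prob_new : ∀ n : ℕ, 1 ≤ n → ∀ π : Finpartition (Finset.Icc 1 n),
    μ.real {ω | P n ω = π ∧ (P (n + 1) ω).parts = insert {n + 1} π.parts}
      = μ.real {ω | P n ω = π} * ((α * (π.parts.card : ℝ) + θ) / ((n : ℝ) + θ))

/-- `K_n`, the number of blocks of the partition of `{1, …, n}`. -/
def numBlocks (P : (n : ℕ) → Ω → Finpartition (Finset.Icc 1 n)) (n : ℕ) (ω : Ω) : ℕ :=
  (P n ω).parts.card

/-- `K_{r,n}`, the number of blocks of size `r` of the partition of `{1, …, n}`. -/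
def numBlocksOfSize (P : (n : ℕ) → Ω → Finpartition (Finset.Icc 1 n)) (r n : ℕ) (ω : Ω) : ℕ :=
  ((P n ω).parts.filter (fun A => A.card = r)).card

lemma measurable_of_measurableSet_eq {P : (n : ℕ) → Ω → Finpartition (Finset.Icc 1 n)}
    (hP : ∀ (n : ℕ) (π : Finpartition (Finset.Icc 1 n)), MeasurableSet {ω | P n ω = π})
    (n : ℕ) (f : Finpartition (Finset.Icc 1 n) → ℕ) : Measurable (fun ω => f (P n ω)) := by
  refine measurable_to_countable' fun x => ?_
  have h : (fun ω => f (P n ω)) ⁻¹' {x} = ⋃ π ∈ {π | f π = x}, {ω | P n ω = π} := by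
    ext ω
    simp
  rw [h]
  exact MeasurableSet.biUnion (Set.toFinite _).countable fun π _ => hP n π

/-- The σ-algebra generated by `K_j, K_{1,j}, …, K_{r,j}`. -/
abbrev blockSigma (P : (n : ℕ) → Ω → Finpartition (Finset.Icc 1 n)) (r j : ℕ) : MeasurableSpace Ω :=
  MeasurableSpace.comap (numBlocks P j) ⊤ ⊔
    ⨆ i ∈ Finset.Icc 1 r, MeasurableSpace.comap (numBlocksOfSize P i j) ⊤

lemma blockSigma_le {P : (n : ℕ) → Ω → Finpartition (Finset.Icc 1 n)}
    (hP : ∀ (n : ℕ) (π : Finpartition (Finset.Icc 1 n)), MeasurableSet {ω | P n ω = π})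
    (r j : ℕ) : blockSigma P r j ≤ mΩ := by
  refine sup_le ?_ (iSup₂_le fun i _ => ?_)
  · exact Measurable.comap_le (measurable_of_measurableSet_eq hP j fun π => π.parts.card)
  · exact Measurable.comap_le (measurable_of_measurableSet_eq hP j
      fun π => (π.parts.filter (fun A : Finset ℕ => A.card = i)).card)

/-- The filtration `F_{r,n} = σ(K_j, K_{1,j}, …, K_{r,j} : 1 ≤ j ≤ n)`. -/
def blockFiltration {P : (n : ℕ) → Ω → Finpartition (Finset.Icc 1 n)}
    (hP : ∀ (n : ℕ) (π : Finpartition (Finset.Icc 1 n)), MeasurableSet {ω | P n ω = π})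
    (r : ℕ) : Filtration ℕ mΩ where
  seq n := ⨆ j ∈ Finset.Icc 1 n, blockSigma P r j
  mono' _ n hmn := iSup₂_le fun j hj => le_iSup₂ (f := fun j (_ : j ∈ Finset.Icc 1 n) =>
    blockSigma P r j) j (Finset.Icc_subset_Icc_right hmn hj)
  le' _ := iSup₂_le fun j _ => blockSigma_le hP r j

/-- `w_n (∑_{i=1}^r b_{r,i} K_{i,n} + (-1)^r p_α(r) K_n + (-1)^r p_α(r) θ / α)`,
for a sequence of weights `w`. -/
def weightedProcess (α θ : ℝ) (P : (n : ℕ) → Ω → Finpartition (Finset.Icc 1 n)) (r : ℕ)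
    (w : ℕ → ℝ) (n : ℕ) (ω : Ω) : ℝ :=
  w n * ((∑ i ∈ Finset.Icc 1 r, coeffB α r i * (numBlocksOfSize P i n ω : ℝ))
    + (-1) ^ r * sibuya α r * (numBlocks P n ω : ℝ) + (-1) ^ r * sibuya α r * θ / α)

/-- The filtration `(F_{s+k})_{k ≥ 0}`. -/
def shiftFiltration (F : Filtration ℕ mΩ) (s : ℕ) : Filtration ℕ mΩ where
  seq k := F (s + k)
  mono' _ _ h := F.mono (Nat.add_le_add_left h s)
  le' k := F.le (s + k)

/-- `(M_n)_{n ≥ s}` is a martingale for `(F_n)_{n ≥ s}` and each `M_n` is square integrable. -/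
def IsSquareIntegrableMartingaleFrom (s : ℕ) (M : ℕ → Ω → ℝ) (F : Filtration ℕ mΩ)
    (μ : Measure Ω) : Prop :=
  Martingale (fun k => M (s + k)) (shiftFiltration F s) μ ∧ ∀ n, s ≤ n → MemLp (M n) 2 μ

/-- The predictable quadratic variation `∑_{k=s}^{n-1} E[(M_{k+1} - M_k)² | F_k]` of a square
integrable martingale `(M_n)_{n ≥ s}`. -/
def predQuadVarFrom (s : ℕ) (M : ℕ → Ω → ℝ) (F : Filtration ℕ mΩ) (μ : Measure Ω)
    (n : ℕ) (ω : Ω) : ℝ :=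
  ∑ k ∈ Finset.Ico s n, (μ[fun ω' => (M (k + 1) ω' - M k ω') ^ 2 | F k]) ω

end Partitions

end EwensPitman

end

/-! Let `X` be the statistic `blockStat`. Attaching to a block of size `i` changes it by `b_{r,i+1}
- b_{r,i}`, and a new block changes it by `b_{r,1} + (-1)^r p_α(r)`. The coefficients are chosen so
that `(i - α)(b_{r,i+1} - b_{r,i}) = (α - r) b_{r,i}`, with a matching relation for new blocks.
Hence `X` is an eigenfunction of the one-step transition operator `expNext`, with eigenvalue `1 + (α
- r)/(n + θ)` (`expNext_blockStat`). The weights are the reciprocals of the products of these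
eigenvalues, so the weighted process is a martingale.

The filtration carries only block counts, while the transition law is conditional on the whole
partition. Deleting `n + 1` recovers the previous partition almost surely, so `F_{r,n}` lies in `σ(P
n)` up to null sets. The relevant transition averages depend only on the counts, so they are the
conditional expectations given `F_{r,n}`.

The increments of the quadratic variation are `w_{n+1}^2` times a linear form in the counts, minus a
squared drift (`condExp_weightedProcess_sq`). Counts of each size have the following asymptotics.
`K_n + θ/α`, suitably normalised, is a nonnegative martingale, which gives `S`. A further
martingale, comparable to `(K_n / n^α)^(-ε)`, forces `S > 0`. A supermartingale built from `X^2`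
gives `X = o(n^α)`. As `b_{r,r} = 1`, induction on `r` then yields `K_{r,n} ~ p_α(r) S n^α`.
Vandermonde's identity evaluates the limiting variance (`incrVar_eq`), Euler's limit for Gamma gives
the size of the weights, and summing powers of `n` concludes. -/

noncomputable section

namespace EwensPitman

/-! ### Asymptotics of products and sums -/

/-- The product `∏_{k = s}^{n-1} (k + a) / (k + b)`. -/
def prodRatio (a b : ℝ) (s n : ℕ) : ℝ := ∏ k ∈ Finset.Ico s n, ((k : ℝ) + a) / ((k : ℝ) + b)

lemma prodRatio_succ (a b : ℝ) {s n : ℕ} (h : s ≤ n) :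
    prodRatio a b s (n + 1) = prodRatio a b s n * (((n : ℝ) + a) / ((n : ℝ) + b)) :=
  Finset.prod_Ico_succ_top h _

lemma prodRatio_pos {a b : ℝ} {s : ℕ} (ha : 0 < (s : ℝ) + a) (hb : 0 < (s : ℝ) + b) (n : ℕ) :
    0 < prodRatio a b s n := by
  refine Finset.prod_pos fun k hk => ?_
  have hk' : (s : ℝ) ≤ k := by exact_mod_cast (Finset.mem_Ico.1 hk).1
  exact div_pos (by linarith) (by linarith)

/-- Euler's approximants are powers over products of affine factors, so their quotient is the
product up to a power of `m`. Zero factors are harmless: both sides then vanish under the convention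
`x / 0 = 0`. -/
lemma GammaSeq_div_GammaSeq (a b : ℝ) (s m : ℕ) (hm : 0 < m) :
    Real.GammaSeq (s + b) m / Real.GammaSeq (s + a) m
      = prodRatio a b s (m + s + 1) * (m : ℝ) ^ (b - a) := by
  have hm' : (0 : ℝ) < m := by exact_mod_cast hm
  have hprod : prodRatio a b s (m + s + 1)
      = (∏ j ∈ Finset.range (m + 1), ((s : ℝ) + a + j))
        / ∏ j ∈ Finset.range (m + 1), ((s : ℝ) + b + j) := by
    rw [prodRatio, Finset.prod_Ico_eq_prod_range, ← Finset.prod_div_distrib,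
      show m + s + 1 - s = m + 1 by omega]
    refine Finset.prod_congr rfl fun j _ => ?_
    push_cast
    ring_nf
  have h1 : (m : ℝ) ^ ((s : ℝ) + b) = (m : ℝ) ^ (b - a) * (m : ℝ) ^ ((s : ℝ) + a) := by
    rw [← Real.rpow_add hm']; ring_nf
  have h2 : (m : ℝ) ^ ((s : ℝ) + a) ≠ 0 := (Real.rpow_pos_of_pos hm' _).ne'
  have h3 : (m.factorial : ℝ) ≠ 0 := by exact_mod_cast m.factorial_ne_zero
  rw [hprod, Real.GammaSeq, Real.GammaSeq, h1, div_div_div_eq]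
  set A := ∏ j ∈ Finset.range (m + 1), ((s : ℝ) + a + j)
  set B := ∏ j ∈ Finset.range (m + 1), ((s : ℝ) + b + j)
  rw [show (m : ℝ) ^ (b - a) * (m : ℝ) ^ ((s : ℝ) + a) * m.factorial * A
    = (A * (m : ℝ) ^ (b - a)) * ((m : ℝ) ^ ((s : ℝ) + a) * m.factorial) by ring,
    mul_div_mul_right _ _ (mul_ne_zero h2 h3)]
  ring

lemma tendsto_natCast_add_div_rpow (s : ℕ) (c : ℝ) :
    Tendsto (fun m : ℕ => (((m + s : ℕ) : ℝ) / (m : ℝ)) ^ c) atTop (𝓝 1) := by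
  have h : Tendsto (fun m : ℕ => (((m + s : ℕ) : ℝ) / (m : ℝ))) atTop (𝓝 1) := by
    have h0 : Tendsto (fun m : ℕ => 1 + (s : ℝ) / (m : ℝ)) atTop (𝓝 (1 + 0)) :=
      tendsto_const_nhds.add (tendsto_const_div_atTop_nhds_zero_nat _)
    rw [add_zero] at h0
    refine h0.congr' ?_
    filter_upwards [eventually_gt_atTop 0] with m hm
    have : (m : ℝ) ≠ 0 := by exact_mod_cast hm.ne'
    push_cast
    field_simp
  simpa using h.rpow_const (p := c) (Or.inl one_ne_zero)

/-- Asymptotics of a product of ratios of affine functions, by Euler's limit formula. -/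
lemma tendsto_prodRatio (a b : ℝ) (s : ℕ) (ha : Real.Gamma (s + a) ≠ 0) :
    Tendsto (fun n : ℕ => prodRatio a b s n * (n : ℝ) ^ (b - a)) atTop
      (𝓝 (Real.Gamma (s + b) / Real.Gamma (s + a))) := by
  rw [← tendsto_add_atTop_iff_nat (s + 1)]
  have h := ((Real.GammaSeq_tendsto_Gamma (s + b)).div (Real.GammaSeq_tendsto_Gamma (s + a)) ha).mul
    (tendsto_natCast_add_div_rpow (s + 1) (b - a))
  rw [mul_one] at h
  refine h.congr' ?_
  filter_upwards [eventually_gt_atTop 0] with m hm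
  have hm' : (0 : ℝ) < m := by exact_mod_cast hm
  simp only [Pi.div_apply]
  rw [GammaSeq_div_GammaSeq a b s m hm, Real.div_rpow (Nat.cast_nonneg _) hm'.le, ← add_assoc]
  have : (m : ℝ) ^ (b - a) ≠ 0 := (Real.rpow_pos_of_pos hm' _).ne'
  field_simp

/-- After division by `n ^ β` this is the difference quotient of `x ^ β` at `1` with step `1 / n`.
-/
lemma tendsto_succ_rpow_sub {β : ℝ} :
    Tendsto (fun n : ℕ => (((n + 1 : ℕ) : ℝ) ^ β - (n : ℝ) ^ β) / (n : ℝ) ^ (β - 1)) atTop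
      (𝓝 β) := by
  have hd : HasDerivAt (fun x : ℝ => x ^ β) β 1 := by
    simpa using Real.hasDerivAt_rpow_const (x := 1) (p := β) (Or.inl one_ne_zero)
  have h := hd.tendsto_slope_zero_right
  have h1 : Tendsto (fun n : ℕ => ((n : ℝ))⁻¹) atTop (𝓝[>] 0) :=
    tendsto_inv_atTop_nhdsGT_zero.comp tendsto_natCast_atTop_atTop
  refine (h.comp h1).congr' ?_
  filter_upwards [eventually_gt_atTop 0] with n hn
  have hn' : (0 : ℝ) < n := by exact_mod_cast hn
  have e1 : (1 : ℝ) + (n : ℝ)⁻¹ = ((n + 1 : ℕ) : ℝ) / n := by push_cast; field_simp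
  simp only [Function.comp, smul_eq_mul, inv_inv, Real.one_rpow]
  rw [e1, Real.div_rpow (Nat.cast_nonneg _) hn'.le, Real.rpow_sub_one hn'.ne']
  have : (n : ℝ) ^ β ≠ 0 := (Real.rpow_pos_of_pos hn' _).ne'
  field_simp

/-- If `u k ~ L k ^ (β - 1)` then `∑_{k = s}^{n-1} u k ~ L n ^ β / β`. -/
lemma tendsto_sum_Ico_div_rpow {β : ℝ} (hβ : 0 < β) {u : ℕ → ℝ} {L : ℝ} (s : ℕ)
    (hu : Tendsto (fun n : ℕ => u n / (n : ℝ) ^ (β - 1)) atTop (𝓝 L)) :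
    Tendsto (fun n : ℕ => (∑ k ∈ Finset.Ico s n, u k) / (n : ℝ) ^ β) atTop (𝓝 (L / β)) := by
  set g : ℕ → ℝ := fun n => ((n + 1 : ℕ) : ℝ) ^ β - (n : ℝ) ^ β with hg
  have hgnn : 0 ≤ g := fun n => sub_nonneg.2 <|
    Real.rpow_le_rpow (Nat.cast_nonneg _) (by push_cast; linarith) hβ.le
  have hgsum : ∀ n, ∑ i ∈ Finset.range n, g i = (n : ℝ) ^ β := fun n => by
    rw [Finset.sum_range_sub (fun k : ℕ => (k : ℝ) ^ β)]
    simp [Real.zero_rpow hβ.ne']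
  have hpow : Tendsto (fun n : ℕ => (n : ℝ) ^ β) atTop atTop :=
    (tendsto_rpow_atTop hβ).comp tendsto_natCast_atTop_atTop
  -- Stolz–Cesàro argument: `g` telescopes to `n ^ β`, which diverges, so the little-o relation
  -- survives summation.
  have hlo : (fun n => u n - L / β * g n) =o[atTop] g := by
    have hgpos : ∀ᶠ n in atTop, 0 < g n := by
      filter_upwards with n
      exact sub_pos.2 <| Real.rpow_lt_rpow (Nat.cast_nonneg _) (by push_cast; linarith) hβ
    rw [Asymptotics.isLittleO_iff_tendsto' (hgpos.mono fun n hn h0 => absurd h0 hn.ne')]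
    have h1 := (hu.div (tendsto_succ_rpow_sub (β := β)) hβ.ne').sub_const (L / β)
    rw [sub_self] at h1
    refine h1.congr' ?_
    filter_upwards [hgpos, eventually_gt_atTop 0] with n hn hn0
    have hn' : (0 : ℝ) < n := by exact_mod_cast hn0
    have h2 : (n : ℝ) ^ (β - 1) ≠ 0 := (Real.rpow_pos_of_pos hn' _).ne'
    have h3 := hn.ne'
    simp only [Pi.div_apply]
    change u n / (n : ℝ) ^ (β - 1) / (g n / (n : ℝ) ^ (β - 1)) - L / β = _
    field_simp
  have hsum := hlo.sum_range hgnn (by simpa only [hgsum] using hpow)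
  simp only [Finset.sum_sub_distrib, ← Finset.mul_sum, hgsum] at hsum
  have hlim := (hsum.tendsto_div_nhds_zero.add_const (L / β)).sub
    (hpow.const_div_atTop (∑ k ∈ Finset.range s, u k))
  rw [zero_add, sub_zero] at hlim
  refine hlim.congr' ?_
  filter_upwards [eventually_ge_atTop s, eventually_gt_atTop 0] with n hn hn0
  have hn' : (0 : ℝ) < n := by exact_mod_cast hn0
  have h2 : (n : ℝ) ^ β ≠ 0 := (Real.rpow_pos_of_pos hn' _).ne'
  rw [Finset.sum_Ico_eq_sub _ hn]
  field_simp
  ring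

/-! ### Algebra of the coefficients and the limiting variance -/

lemma rising_succ_right (x : ℝ) (n : ℕ) : rising x (n + 1) = rising x n * (x + n) :=
  ascPochhammer_succ_eval n x

lemma rising_add (x : ℝ) (n m : ℕ) : rising x (n + m) = rising x n * rising (x + n) m := by
  rw [rising, ← ascPochhammer_mul, Polynomial.eval_mul, Polynomial.eval_comp]
  simp [rising]

lemma rising_zero (x : ℝ) : rising x 0 = 1 := by simp [rising]

lemma rising_one (x : ℝ) : rising x 1 = x := by simp [rising]

lemma rising_succ_left (x : ℝ) (n : ℕ) : rising x (n + 1) = x * rising (x + 1) n := by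
  rw [add_comm, rising_add, rising_one, Nat.cast_one]

lemma rising_eq_factorial_mul_choose (x : ℝ) (n : ℕ) :
    rising (x - n + 1) n = n.factorial * Ring.choose x n := by
  have h := Ring.descPochhammer_eq_factorial_smul_choose x n
  rw [Polynomial.descPochhammer_smeval_eq_ascPochhammer, Polynomial.ascPochhammer_smeval_eq_eval,
    nsmul_eq_mul] at h
  exact h

/-- Vandermonde's identity. -/
lemma sum_choose_mul_choose (x : ℝ) (r : ℕ) :
    ∑ j ∈ Finset.range (r + 1), (r.choose j : ℝ) * Ring.choose x j
      = rising (x + 1) r / r.factorial := by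
  -- Expand the generalized binomial coefficient of `x + r` over `r`.
  have h := rising_eq_factorial_mul_choose (x + r) r
  rw [show x + r - r + 1 = x + 1 by ring, Ring.add_choose_eq r (Commute.all _ _)] at h
  rw [h, mul_div_cancel_left₀ _ (by exact_mod_cast r.factorial_ne_zero),
    Finset.Nat.sum_antidiagonal_eq_sum_range_succ_mk]
  refine Finset.sum_congr rfl fun j hj => ?_
  rw [Ring.choose_natCast, Nat.choose_symm (by simpa [Nat.lt_succ_iff] using hj), mul_comm]

lemma coeffB_self (α : ℝ) (r : ℕ) : coeffB α r r = 1 := by simp [coeffB, rising_zero]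

/-- The rising factorials concatenate, `(1-α)^{(i-1)} (i-α)^{(r-i)} = (1-α)^{(r-1)}`, leaving a
ratio of factorials. -/
lemma sibuya_mul_coeffB (α : ℝ) {r i : ℕ} (hi : 1 ≤ i) (hir : i ≤ r) :
    sibuya α i * coeffB α r i = (-1) ^ (r - i) * sibuya α r * r.choose i := by
  obtain ⟨i, rfl⟩ : ∃ k, i = k + 1 := ⟨i - 1, by omega⟩
  obtain ⟨j, rfl⟩ := Nat.exists_eq_add_of_le hir
  have h1 : rising (1 - α) (i + j) = rising (1 - α) i * rising ((i + 1 : ℕ) - α) j := by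
    rw [rising_add]; push_cast; ring_nf
  have hc : ((i + 1 + j).choose (i + 1) : ℝ) * (i + 1).factorial * j.factorial
      = (i + 1 + j).factorial := by
    have := Nat.choose_mul_factorial_mul_factorial hir
    rw [show i + 1 + j - (i + 1) = j by omega] at this
    exact_mod_cast this
  have f1 : ((i + 1).factorial : ℝ) ≠ 0 := by exact_mod_cast Nat.factorial_ne_zero _
  have f2 : (j.factorial : ℝ) ≠ 0 := by exact_mod_cast Nat.factorial_ne_zero _
  have f3 : ((i + 1 + j).factorial : ℝ) ≠ 0 := by exact_mod_cast Nat.factorial_ne_zero _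
  simp only [sibuya, coeffB, show i + 1 + j - (i + 1) = j by omega,
    show i + 1 + j - 1 = i + j by omega, show i + 1 - 1 = i by omega, h1]
  rw [div_mul_div_comm, mul_div_assoc', div_mul_eq_mul_div, div_eq_div_iff (mul_ne_zero f1 f2) f3,
    ← hc]
  ring

lemma coeffB_succ (α : ℝ) {r i : ℕ} (hir : i < r) :
    ((i : ℝ) - α) * coeffB α r (i + 1) = ((i : ℝ) - r) * coeffB α r i := by
  obtain ⟨j, rfl⟩ := Nat.exists_eq_add_of_le (Nat.succ_le_of_lt hir)
  have f2 : (j.factorial : ℝ) ≠ 0 := by exact_mod_cast Nat.factorial_ne_zero _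
  simp only [coeffB, Nat.succ_eq_add_one, show i + 1 + j - (i + 1) = j by omega,
    show i + 1 + j - i = j + 1 by omega, rising_succ_left, Nat.factorial_succ, pow_succ]
  push_cast
  rw [show (i : ℝ) + 1 - α = i - α + 1 by ring]
  field_simp
  ring

/-- The coefficients `b_{r,i}`, extended by `0` to all indices. -/
def extCoeffB (α : ℝ) (r i : ℕ) : ℝ := if i ∈ Finset.Icc 1 r then coeffB α r i else 0

lemma extCoeffB_of_mem {α : ℝ} {r i : ℕ} (h : i ∈ Finset.Icc 1 r) :
    extCoeffB α r i = coeffB α r i := if_pos h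

lemma extCoeffB_of_lt {α : ℝ} {r i : ℕ} (h : r < i) : extCoeffB α r i = 0 :=
  if_neg (by simp; omega)

/-- The eigenvector relation for growth of a block. At `i = r` it relies on the extension being `0`
at `r + 1`. -/
lemma extCoeffB_succ_sub (α : ℝ) {r i : ℕ} (hi : 1 ≤ i) :
    ((i : ℝ) - α) * (extCoeffB α r (i + 1) - extCoeffB α r i) = (α - r) * extCoeffB α r i := by
  rcases lt_trichotomy i r with h | rfl | h
  · have := coeffB_succ α h
    rw [extCoeffB_of_mem (i := i) (by simp; omega), extCoeffB_of_mem (i := i + 1) (by simp; omega)]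
    linear_combination this
  · rw [extCoeffB_of_lt (by omega : i < i + 1)]
    ring
  · rw [extCoeffB_of_lt h, extCoeffB_of_lt (by omega : r < i + 1)]
    ring

/-- The coefficient `(-1)^r p_α(r)` of `K_n`. -/
def coeffK (α : ℝ) (r : ℕ) : ℝ := (-1) ^ r * sibuya α r

/-- The eigenvector relation for new blocks. It is the growth relation at `i = 0`, since the formula
for `b_{r,0}` formally gives `-coeffK α r`. -/
lemma coeffB_one_add_coeffK (α : ℝ) {r : ℕ} (hr : 1 ≤ r) :
    α * (extCoeffB α r 1 + coeffK α r) = (α - r) * coeffK α r := by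
  rw [extCoeffB_of_mem (by simp; omega)]
  obtain ⟨j, rfl⟩ : ∃ k, r = k + 1 := ⟨r - 1, by omega⟩
  have f2 : (j.factorial : ℝ) ≠ 0 := by exact_mod_cast Nat.factorial_ne_zero _
  simp only [coeffB, coeffK, sibuya, Nat.add_sub_cancel, Nat.factorial_succ, pow_succ]
  push_cast
  field_simp
  ring

/-- Reduces to the vanishing alternating sum of binomial coefficients. It says that the limiting
proportions `p_α(i)` annihilate the linear part of the statistic. -/
lemma sum_coeffB_mul_sibuya (α : ℝ) {r : ℕ} (hr : 1 ≤ r) :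
    ∑ i ∈ Finset.Icc 1 r, coeffB α r i * sibuya α i + coeffK α r = 0 := by
  have h : ∑ i ∈ Finset.range (r + 1), (-1 : ℝ) ^ i * r.choose i = 0 := by
    have := Int.alternating_sum_range_choose_of_ne (n := r) (by omega)
    exact_mod_cast congrArg (Int.cast : ℤ → ℝ) this
  rw [Finset.range_eq_Ico, Finset.sum_eq_sum_Ico_succ_bot (by omega)] at h
  have h2 : ∑ i ∈ Finset.Icc 1 r, coeffB α r i * sibuya α i
      = (-1) ^ r * sibuya α r * ∑ i ∈ Finset.Ico (0 + 1) (r + 1), (-1 : ℝ) ^ i * r.choose i := by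
    rw [Finset.mul_sum]
    refine Finset.sum_congr (by ext; simp) fun i hi => ?_
    have hi' := Finset.mem_Ico.1 hi
    rw [mul_comm, sibuya_mul_coeffB α (by omega) (by omega)]
    have : (-1 : ℝ) ^ r * (-1) ^ i = (-1) ^ (r - i) := by
      rw [← pow_add, show r + i = (r - i) + 2 * i by omega, pow_add, pow_mul]
      simp
    rw [← this]
    ring
  rw [h2, coeffK, eq_neg_of_add_eq_zero_right h]
  simp

/-- The limiting variance of the increments. -/
def incrVar (α : ℝ) (r : ℕ) : ℝ :=
  (extCoeffB α r 1 + coeffK α r) ^ 2 * α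
    + ∑ i ∈ Finset.Icc 1 r,
      sibuya α i * (((i : ℝ) - α) * (extCoeffB α r (i + 1) - extCoeffB α r i) ^ 2)

lemma sibuya_mul_coeffB_sq (α : ℝ) {r i : ℕ} (hα : (r : ℝ) - α ≠ 0) (hi0 : (i : ℝ) - α ≠ 0)
    (hi : 1 ≤ i) (hir : i ≤ r) :
    sibuya α i * coeffB α r i ^ 2
      = ((i : ℝ) - α) * (sibuya α r / (r - α) * (r.choose (r - i) * Ring.choose (r - α) (r - i))) := by
  have h1 := sibuya_mul_coeffB α hi hir
  have hx : rising ((i : ℝ) - α) (r - i) * (r - α)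
      = (i - α) * ((r - i).factorial * Ring.choose (r - α) (r - i)) := by
    rw [← rising_eq_factorial_mul_choose, Nat.cast_sub hir,
      show (r : ℝ) - α - (r - i) + 1 = i - α + 1 by ring, ← rising_succ_left, rising_succ_right,
      Nat.cast_sub hir]
    ring
  have f2 : ((r - i).factorial : ℝ) ≠ 0 := by exact_mod_cast Nat.factorial_ne_zero _
  have hs : ((-1 : ℝ) ^ (r - i)) ^ 2 = 1 := by rw [← pow_mul, mul_comm, pow_mul]; simp
  have hb : coeffB α r i
      = (-1) ^ (r - i) * ((i - α) * Ring.choose ((r : ℝ) - α) (r - i) / (r - α)) := by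
    rw [coeffB, mul_div_assoc]
    congr 1
    rw [div_eq_div_iff f2 hα, hx]
    ring
  rw [sq, ← mul_assoc, h1, hb, Nat.choose_symm hir]
  field_simp
  rw [hs, one_mul]

/-- The eigenvector relations turn every squared jump into the product of two binomial coefficients,
of `r` and of `r - α` over `r - i`, with a common prefactor. Vandermonde's identity sums them. -/
lemma incrVar_eq {α : ℝ} (hα0 : 0 < α) (hα1 : α < 1) {r : ℕ} (hr : 1 ≤ r) :
    incrVar α r
      = (2 * (r : ℝ) - α) * (sibuya α r * (rising ((r : ℝ) - α) r / (r.factorial : ℝ))) := by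
  have hr' : (1 : ℝ) ≤ r := by exact_mod_cast hr
  have hra : (r : ℝ) - α ≠ 0 := by linarith
  have hterm : ∀ i ∈ Finset.Icc 1 r,
      sibuya α i * (((i : ℝ) - α) * (extCoeffB α r (i + 1) - extCoeffB α r i) ^ 2)
        = (r - α) * sibuya α r * (r.choose (r - i) * Ring.choose (r - α) (r - i)) := by
    intro i hi
    have hi' := Finset.mem_Icc.1 hi
    have : (1 : ℝ) ≤ i := by exact_mod_cast hi'.1
    have hi0 : (i : ℝ) - α ≠ 0 := by linarith
    have h1 := extCoeffB_succ_sub α (r := r) hi'.1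
    have h2 := sibuya_mul_coeffB_sq α hra hi0 hi'.1 hi'.2
    rw [extCoeffB_of_mem hi] at h1 ⊢
    have h3 : extCoeffB α r (i + 1) - coeffB α r i = (α - r) * coeffB α r i / (i - α) := by
      rw [← h1]; field_simp
    rw [h3]
    have : sibuya α i * (((i : ℝ) - α) * ((α - r) * coeffB α r i / (i - α)) ^ 2)
      = (r - α) ^ 2 / (i - α) * (sibuya α i * coeffB α r i ^ 2) := by field_simp; ring
    rw [this, h2]
    field_simp
  -- The new-block term is the missing `i = 0` term of the same family.
  have h0 : (extCoeffB α r 1 + coeffK α r) ^ 2 * α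
      = (r - α) * sibuya α r * (r.choose (r - 0) * Ring.choose (r - α) (r - 0)) := by
    have h1 := coeffB_one_add_coeffK α hr
    have h3 : extCoeffB α r 1 + coeffK α r = (α - r) * coeffK α r / α := by
      rw [← h1]; field_simp
    have hs : ((-1 : ℝ) ^ r) ^ 2 = 1 := by rw [← pow_mul, mul_comm, pow_mul]; simp
    have hc : Ring.choose ((r : ℝ) - α) r * α = (r - α) * sibuya α r := by
      have := rising_eq_factorial_mul_choose ((r : ℝ) - α) r
      obtain ⟨j, rfl⟩ : ∃ k, r = k + 1 := ⟨r - 1, by omega⟩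
      have f2 : ((j + 1).factorial : ℝ) ≠ 0 := by exact_mod_cast Nat.factorial_ne_zero _
      rw [show ((j + 1 : ℕ) : ℝ) - α - (j + 1 : ℕ) + 1 = 1 - α by ring, rising_succ_right] at this
      rw [sibuya, Nat.add_sub_cancel, eq_div_of_mul_eq f2 (mul_comm _ _ |>.trans this.symm)]
      push_cast
      field_simp
      ring
    rw [h3, Nat.sub_zero, Nat.choose_self, coeffK, Nat.cast_one, one_mul,
      eq_div_of_mul_eq hα0.ne' hc]
    field_simp
    rw [hs]
    ring
  have hsum : incrVar α r = (r - α) * sibuya α r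
      * ∑ i ∈ Finset.range (r + 1), (r.choose i : ℝ) * Ring.choose ((r : ℝ) - α) i := by
    rw [← Finset.sum_range_reflect, Finset.range_eq_Ico,
      Finset.sum_eq_sum_Ico_succ_bot (by omega), incrVar, Finset.sum_congr rfl hterm, h0,
      ← Finset.mul_sum, ← mul_add]
    congr 2
  have h2 : ((r : ℝ) - α) * rising (r - α + 1) r = rising (r - α) r * (2 * r - α) := by
    rw [← rising_succ_left, rising_succ_right]
    ring
  rw [hsum, sum_choose_mul_choose]
  linear_combination (sibuya α r / r.factorial) * h2

/-! ### Combinatorics of one transition -/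

/-- The blocks of the partition obtained by attaching `n + 1` to the block `A`. -/
def attachParts (n : ℕ) (T : Finset (Finset ℕ)) (A : Finset ℕ) : Finset (Finset ℕ) :=
  insert (insert (n + 1) A) (T.erase A)

/-- The blocks of the partition obtained by adding the block `{n + 1}`. -/
def newParts (n : ℕ) (T : Finset (Finset ℕ)) : Finset (Finset ℕ) := insert {n + 1} T

/-- The number of blocks of size `i`. -/
def sizeCount (i : ℕ) (T : Finset (Finset ℕ)) : ℕ := (T.filter (fun A => A.card = i)).card

/-- The non-empty traces of the blocks on the complement of `{m}`. -/
def dropElem (m : ℕ) (T : Finset (Finset ℕ)) : Finset (Finset ℕ) :=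
  (T.image fun B => B.erase m).erase ∅

/-- The transition operator of the chain of partitions. -/
def expNext (α θ : ℝ) (n : ℕ) (Φ : Finset (Finset ℕ) → ℝ) (T : Finset (Finset ℕ)) : ℝ :=
  ∑ A ∈ T, ((A.card : ℝ) - α) / ((n : ℝ) + θ) * Φ (attachParts n T A)
    + (α * (T.card : ℝ) + θ) / ((n : ℝ) + θ) * Φ (newParts n T)

/-- The possible successors of a partition. -/
def nextParts (n : ℕ) (T : Finset (Finset ℕ)) : Finset (Finset (Finset ℕ)) :=
  insert (newParts n T) (T.image (attachParts n T))

section Combinatorics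

variable {n : ℕ} (π : Finpartition (Finset.Icc 1 n))

lemma succ_notMem_block {A : Finset ℕ} (hA : A ∈ π.parts) : n + 1 ∉ A := fun h => by
  have := Finset.mem_Icc.1 (π.le hA h)
  omega

lemma block_card_pos {A : Finset ℕ} (hA : A ∈ π.parts) : 1 ≤ A.card :=
  Finset.card_pos.2 (π.nonempty_of_mem_parts hA)

lemma insert_notMem_parts (A : Finset ℕ) : insert (n + 1) A ∉ π.parts := fun h =>
  succ_notMem_block π h (Finset.mem_insert_self _ _)

lemma singleton_notMem_parts : ({n + 1} : Finset ℕ) ∉ π.parts := insert_notMem_parts π ∅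

lemma card_attachParts {A : Finset ℕ} (hA : A ∈ π.parts) :
    (attachParts n π.parts A).card = π.parts.card := by
  rw [attachParts, Finset.card_insert_of_notMem
    (fun h => insert_notMem_parts π A (Finset.mem_of_mem_erase h)), Finset.card_erase_add_one hA]

lemma card_newParts : (newParts n π.parts).card = π.parts.card + 1 :=
  Finset.card_insert_of_notMem (singleton_notMem_parts π)

lemma sizeCount_attachParts {A : Finset ℕ} (hA : A ∈ π.parts) (i : ℕ) :
    (sizeCount i (attachParts n π.parts A) : ℝ)
      = sizeCount i π.parts + (if A.card + 1 = i then 1 else 0) - if A.card = i then 1 else 0 := by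
  have h1 : insert (n + 1) A ∉ (π.parts.erase A).filter (fun B => B.card = i) := fun h =>
    insert_notMem_parts π A (Finset.mem_of_mem_erase (Finset.mem_of_mem_filter _ h))
  have h2 : ((((π.parts.erase A).filter (fun B => B.card = i)).card : ℕ) : ℝ)
      = sizeCount i π.parts - if A.card = i then 1 else 0 := by
    rw [Finset.filter_erase, sizeCount]
    split_ifs with h
    · rw [Finset.card_erase_of_mem (Finset.mem_filter.2 ⟨hA, h⟩), Nat.cast_sub, Nat.cast_one]
      exact Finset.card_pos.2 ⟨A, Finset.mem_filter.2 ⟨hA, h⟩⟩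
    · rw [Finset.erase_eq_of_notMem (by simp [h]), sub_zero]
  rw [sizeCount, attachParts, Finset.filter_insert,
    Finset.card_insert_of_notMem (succ_notMem_block π hA)]
  split_ifs at h2 ⊢ with h3 h4 h4
  · omega
  · rw [Finset.card_insert_of_notMem h1]; push_cast; rw [h2]; ring
  · rw [h2]; ring
  · rw [h2]; ring

lemma sizeCount_newParts (i : ℕ) :
    (sizeCount i (newParts n π.parts) : ℝ) = sizeCount i π.parts + if i = 1 then 1 else 0 := by
  have h1 : {n + 1} ∉ π.parts.filter (fun B => B.card = i) := fun h =>
    singleton_notMem_parts π (Finset.mem_of_mem_filter _ h)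
  rw [sizeCount, newParts, Finset.filter_insert, Finset.card_singleton]
  by_cases h : i = 1
  · rw [if_pos h.symm, if_pos h, Finset.card_insert_of_notMem h1]; push_cast; rfl
  · rw [if_neg (Ne.symm h), if_neg h, add_zero]; rfl

/-- Grouping blocks by size expresses transition averages through the counts up to size `r`, hence
makes them measurable for the small filtration. -/
lemma sum_parts_eq_sum_sizeCount (r : ℕ) (g : ℕ → ℝ) (hg : ∀ i, r < i → g i = 0) :
    ∑ A ∈ π.parts, g A.card = ∑ i ∈ Finset.Icc 1 r, (sizeCount i π.parts : ℝ) * g i := by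
  have h : ∑ A ∈ π.parts, g A.card = ∑ A ∈ π.parts with A.card ∈ Finset.Icc 1 r, g A.card := by
    refine (Finset.sum_filter_of_ne fun A hA h => Finset.mem_Icc.2 ⟨block_card_pos π hA, ?_⟩).symm
    exact not_lt.1 fun h' => h (hg _ h')
  rw [h, ← Finset.sum_fiberwise_of_maps_to
    (g := Finset.card) (t := Finset.Icc 1 r) (fun A hA => (Finset.mem_filter.1 hA).2)]
  refine Finset.sum_congr rfl fun i hi => ?_
  rw [Finset.sum_congr rfl (g := fun _ => g i) (fun A hA => by
    rw [(Finset.mem_filter.1 hA).2]), Finset.sum_const, nsmul_eq_mul, sizeCount,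
    Finset.filter_filter]
  congr 3
  refine Finset.filter_congr fun A _ => ⟨fun h => h.2, fun h => ⟨h ▸ hi, h⟩⟩

lemma sizeCount_le (i : ℕ) (T : Finset (Finset ℕ)) : sizeCount i T ≤ T.card :=
  Finset.card_filter_le _ _

lemma attachParts_injOn : Set.InjOn (attachParts n π.parts) π.parts := by
  intro A hA B hB h
  have h1 : insert (n + 1) A ∈ attachParts n π.parts B := h ▸ Finset.mem_insert_self _ _
  rcases Finset.mem_insert.1 h1 with h2 | h2
  · rw [← Finset.erase_insert (succ_notMem_block π hA), h2,
      Finset.erase_insert (succ_notMem_block π hB)]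
  · exact absurd (Finset.mem_of_mem_erase h2) (insert_notMem_parts π A)

lemma newParts_notMem_image : newParts n π.parts ∉ π.parts.image (attachParts n π.parts) := by
  intro h
  obtain ⟨A, hA, h⟩ := Finset.mem_image.1 h
  have h1 := congrArg Finset.card h
  rw [card_attachParts π hA, card_newParts] at h1
  omega

lemma image_erase_parts {T : Finset (Finset ℕ)} (hT : T ⊆ π.parts) :
    (T.image fun B => B.erase (n + 1)) = T := by
  have h : (T.image fun B => B.erase (n + 1)) = T.image id :=
    Finset.image_congr fun B hB =>
      Finset.erase_eq_of_notMem (succ_notMem_block π (hT (Finset.mem_coe.1 hB)))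
  rw [h, Finset.image_id]

lemma dropElem_of_mem_nextParts {T : Finset (Finset ℕ)} (hT : T ∈ nextParts n π.parts) :
    dropElem (n + 1) T = π.parts := by
  have he : ∅ ∉ π.parts := π.empty_notMem_parts
  rcases Finset.mem_insert.1 hT with rfl | hT
  · rw [dropElem, newParts, Finset.image_insert, image_erase_parts π subset_rfl,
      Finset.erase_singleton, Finset.erase_insert he]
  · obtain ⟨A, hA, rfl⟩ := Finset.mem_image.1 hT
    rw [dropElem, attachParts, Finset.image_insert,
      image_erase_parts π (Finset.erase_subset _ _),
      Finset.erase_insert (succ_notMem_block π hA), Finset.insert_erase hA,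
      Finset.erase_eq_of_notMem he]

lemma sum_card_sub (α : ℝ) :
    ∑ A ∈ π.parts, ((A.card : ℝ) - α) = n - α * π.parts.card := by
  rw [Finset.sum_sub_distrib, Finset.sum_const, nsmul_eq_mul, ← Nat.cast_sum,
    π.sum_card_parts, Nat.card_Icc]
  push_cast [Nat.add_sub_cancel]
  ring

/-- The transition probabilities sum to `1`, because the block sizes sum to `n`. -/
lemma expNext_const {α θ : ℝ} (hn : (n : ℝ) + θ ≠ 0) (c : ℝ) :
    expNext α θ n (fun _ => c) π.parts = c := by
  rw [expNext, ← Finset.sum_mul, ← Finset.sum_div, sum_card_sub]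
  field_simp
  ring

end Combinatorics

/-! ### Conditional expectations given the block counts -/

section FiniteValued

variable {Ω : Type*} {mΩ : MeasurableSpace Ω} {μ : Measure Ω}

lemma measurable_comp_of_finite {β γ : Type*} [Finite β] [MeasurableSpace γ] {X : Ω → β}
    (hX : ∀ b, MeasurableSet {ω | X ω = b}) (f : β → γ) : Measurable fun ω => f (X ω) := by
  intro s _
  have h : (fun ω => f (X ω)) ⁻¹' s = ⋃ b ∈ {b | f b ∈ s}, {ω | X ω = b} := by
    ext ω
    simp
  rw [h]
  exact MeasurableSet.biUnion (Set.toFinite _).countable fun b _ => hX b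

lemma memLp_comp_of_finite [IsFiniteMeasure μ] {β : Type*} [Finite β] {X : Ω → β}
    (hX : ∀ b, MeasurableSet {ω | X ω = b}) (f : β → ℝ) (p : ENNReal) :
    MemLp (fun ω => f (X ω)) p μ := by
  obtain ⟨C, hC⟩ := (Set.finite_range fun b => ‖f b‖).bddAbove
  exact MemLp.of_bound (measurable_comp_of_finite hX f).aestronglyMeasurable C
    (ae_of_all _ fun ω => hC ⟨X ω, rfl⟩)

lemma measurableSet_pair_eq {β γ : Type*} {X : Ω → β} {Y : Ω → γ}
    (hX : ∀ b, MeasurableSet {ω | X ω = b}) (hY : ∀ b, MeasurableSet {ω | Y ω = b}) (b : β × γ) :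
    MeasurableSet {ω | (X ω, Y ω) = b} := by
  have h : {ω | (X ω, Y ω) = b} = {ω | X ω = b.1} ∩ {ω | Y ω = b.2} := by
    ext ω
    simp [Prod.ext_iff]
  rw [h]
  exact (hX _).inter (hY _)

end FiniteValued

section OneStep

variable {Ω : Type*} {mΩ : MeasurableSpace Ω} {μ : Measure Ω}
  {α θ : ℝ} {P : (n : ℕ) → Ω → Finpartition (Finset.Icc 1 n)}

lemma measurableSet_next (hP : IsEwensPitmanProcess μ α θ P) (n : ℕ)
    (π : Finpartition (Finset.Icc 1 n)) (T : Finset (Finset ℕ)) :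
    MeasurableSet {ω | P n ω = π ∧ (P (n + 1) ω).parts = T} := by
  have h := measurable_comp_of_finite (hP.measurableSet_eq (n + 1))
    (fun ρ => (ρ.parts = T : Prop))
  exact (hP.measurableSet_eq n π).inter (measurableSet_setOfPred.2 h)

lemma sum_nextParts (hP : IsEwensPitmanProcess μ α θ P) {n : ℕ} (hn : 1 ≤ n)
    (π : Finpartition (Finset.Icc 1 n)) (Φ : Finset (Finset ℕ) → ℝ) :
    ∑ T ∈ nextParts n π.parts, μ.real {ω | P n ω = π ∧ (P (n + 1) ω).parts = T} * Φ T
      = μ.real {ω | P n ω = π} * expNext α θ n Φ π.parts := by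
  rw [nextParts, Finset.sum_insert (newParts_notMem_image π),
    Finset.sum_image (attachParts_injOn π), expNext, mul_add, Finset.mul_sum, add_comm]
  congr 1
  · refine Finset.sum_congr rfl fun A hA => ?_
    rw [attachParts, hP.prob_attach n hn π A hA]
    ring
  · rw [newParts, hP.prob_new n hn π]
    ring

lemma pairwiseDisjoint_next (n : ℕ) (π : Finpartition (Finset.Icc 1 n))
    (s : Set (Finset (Finset ℕ))) :
    s.PairwiseDisjoint fun T => {ω | P n ω = π ∧ (P (n + 1) ω).parts = T} :=
  fun _ _ _ _ hne => Set.disjoint_left.2 fun _ h1 h2 => hne (h1.2.symm.trans h2.2)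

lemma measurable_numBlocks (hP : IsEwensPitmanProcess μ α θ P) (r : ℕ) {n : ℕ} (hn : 1 ≤ n) :
    Measurable[blockFiltration hP.measurableSet_eq r n] (numBlocks P n) := by
  refine Measurable.mono (comap_measurable (numBlocks P n)) ?_ le_rfl
  exact le_sup_left.trans (le_iSup₂ (f := fun j (_ : j ∈ Finset.Icc 1 n) => blockSigma P r j) n
    (Finset.mem_Icc.2 ⟨hn, le_rfl⟩))

lemma measurable_numBlocksOfSize (hP : IsEwensPitmanProcess μ α θ P) {r i : ℕ}
    (hi : i ∈ Finset.Icc 1 r) {n : ℕ} (hn : 1 ≤ n) :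
    Measurable[blockFiltration hP.measurableSet_eq r n] (numBlocksOfSize P i n) := by
  refine Measurable.mono (comap_measurable (numBlocksOfSize P i n)) ?_ le_rfl
  refine le_trans ?_ (le_iSup₂ (f := fun j (_ : j ∈ Finset.Icc 1 n) => blockSigma P r j) n
    (Finset.mem_Icc.2 ⟨hn, le_rfl⟩))
  exact le_sup_of_le_right (le_iSup₂ (f := fun i (_ : i ∈ Finset.Icc 1 r) =>
    MeasurableSpace.comap (numBlocksOfSize P i n) ⊤) i hi)

variable [IsProbabilityMeasure μ]

lemma measureReal_biUnion_next (hP : IsEwensPitmanProcess μ α θ P) {n : ℕ} (hn : 1 ≤ n)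
    (hθ : (n : ℝ) + θ ≠ 0) (π : Finpartition (Finset.Icc 1 n)) :
    μ.real (⋃ T ∈ nextParts n π.parts, {ω | P n ω = π ∧ (P (n + 1) ω).parts = T})
      = μ.real {ω | P n ω = π} := by
  rw [measureReal_biUnion_finset (pairwiseDisjoint_next n π _)
    (fun T _ => measurableSet_next hP n π T)]
  simpa [expNext_const π hθ] using sum_nextParts hP hn π fun _ => 1

/-- The structure does not require `P (n + 1)` to extend `P n`. This holds almost surely because the
prescribed probabilities already exhaust the mass of `{P n = π}`. -/
lemma biUnion_next_ae_eq (hP : IsEwensPitmanProcess μ α θ P) {n : ℕ} (hn : 1 ≤ n)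
    (hθ : (n : ℝ) + θ ≠ 0) (π : Finpartition (Finset.Icc 1 n)) :
    (⋃ T ∈ nextParts n π.parts, {ω | P n ω = π ∧ (P (n + 1) ω).parts = T} : Set Ω)
      =ᵐ[μ] {ω | P n ω = π} := by
  refine ae_eq_of_subset_of_measure_ge (Set.iUnion₂_subset fun T _ ω h => h.1) ?_
    (Finset.measurableSet_biUnion _ fun T _ => measurableSet_next hP n π T).nullMeasurableSet
    (measure_ne_top _ _)
  rw [← ENNReal.toReal_le_toReal (measure_ne_top _ _) (measure_ne_top _ _)]
  exact (measureReal_biUnion_next hP hn hθ π).ge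

lemma ae_mem_nextParts (hP : IsEwensPitmanProcess μ α θ P) {n : ℕ} (hn : 1 ≤ n)
    (hθ : (n : ℝ) + θ ≠ 0) :
    ∀ᵐ ω ∂μ, (P (n + 1) ω).parts ∈ nextParts n (P n ω).parts := by
  have h : ∀ᵐ ω ∂μ, ∀ π : Finpartition (Finset.Icc 1 n),
      (ω ∈ (⋃ T ∈ nextParts n π.parts, {ω | P n ω = π ∧ (P (n + 1) ω).parts = T} : Set Ω))
        = (P n ω = π) := ae_all_iff.2 fun π => biUnion_next_ae_eq hP hn hθ π
  filter_upwards [h] with ω hω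
  have h1 := (hω (P n ω)).mpr rfl
  simp only [Set.mem_iUnion, Set.mem_ofPred_eq, true_and] at h1
  obtain ⟨T, hT, h2⟩ := h1
  exact h2 ▸ hT

/-- Almost surely, the later partitions determine the earlier ones. -/
lemma exists_parts_ae_eq (hP : IsEwensPitmanProcess μ α θ P)
    (hθ : ∀ n : ℕ, 1 ≤ n → (n : ℝ) + θ ≠ 0) {j n : ℕ} (hj : 1 ≤ j) (hjn : j ≤ n) :
    ∃ ρ : Finset (Finset ℕ) → Finset (Finset ℕ),
      ∀ᵐ ω ∂μ, (P j ω).parts = ρ (P n ω).parts := by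
  induction n, hjn using Nat.le_induction with
  | base => exact ⟨id, ae_of_all _ fun _ => rfl⟩
  | succ n hjn ih =>
    obtain ⟨ρ, hρ⟩ := ih
    refine ⟨fun T => ρ (dropElem (n + 1) T), ?_⟩
    filter_upwards [hρ, ae_mem_nextParts hP (hj.trans hjn) (hθ n (hj.trans hjn))] with ω h1 h2
    rw [h1, dropElem_of_mem_nextParts _ h2]

lemma comap_parts_le_eventuallyMeasurableSpace (hP : IsEwensPitmanProcess μ α θ P)
    (hθ : ∀ n : ℕ, 1 ≤ n → (n : ℝ) + θ ≠ 0) {j n : ℕ} (hj : 1 ≤ j) (hjn : j ≤ n)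
    (f : Finset (Finset ℕ) → ℕ) :
    MeasurableSpace.comap (fun ω => f (P j ω).parts) ⊤
      ≤ eventuallyMeasurableSpace (MeasurableSpace.comap (P n) ⊤) (ae μ) := by
  obtain ⟨ρ, hρ⟩ := exists_parts_ae_eq hP hθ hj hjn
  rintro s ⟨B, -, rfl⟩
  refine ⟨{ω | f (ρ (P n ω).parts) ∈ B}, ⟨{π | f (ρ π.parts) ∈ B}, trivial, rfl⟩, ?_⟩
  filter_upwards [hρ] with ω hω
  change (f (P j ω).parts ∈ B) = (f (ρ (P n ω).parts) ∈ B)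
  rw [hω]

/-- Each earlier partition is almost surely a function of `P n`, so conditioning on the past counts
needs only the law given `P n`. -/
lemma blockFiltration_le_eventuallyMeasurableSpace (hP : IsEwensPitmanProcess μ α θ P)
    (hθ : ∀ n : ℕ, 1 ≤ n → (n : ℝ) + θ ≠ 0) (r n : ℕ) :
    blockFiltration hP.measurableSet_eq r n
      ≤ eventuallyMeasurableSpace (MeasurableSpace.comap (P n) ⊤) (ae μ) := by
  refine iSup₂_le fun j hj => sup_le ?_ (iSup₂_le fun i _ => ?_)
  · exact comap_parts_le_eventuallyMeasurableSpace hP hθ (Finset.mem_Icc.1 hj).1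
      (Finset.mem_Icc.1 hj).2 Finset.card
  · exact comap_parts_le_eventuallyMeasurableSpace hP hθ (Finset.mem_Icc.1 hj).1
      (Finset.mem_Icc.1 hj).2 (sizeCount i)

lemma memLp_comp_parts (hP : IsEwensPitmanProcess μ α θ P) (n : ℕ)
    (f : Finset (Finset ℕ) → ℝ) (p : ENNReal) : MemLp (fun ω => f (P n ω).parts) p μ :=
  memLp_comp_of_finite (hP.measurableSet_eq n) (fun π => f π.parts) p

lemma integrable_comp_parts (hP : IsEwensPitmanProcess μ α θ P) (n : ℕ)
    (f : Finset (Finset ℕ) → ℝ) : Integrable (fun ω => f (P n ω).parts) μ :=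
  memLp_one_iff_integrable.1 (memLp_comp_parts hP n f 1)

lemma integrable_comp_parts_succ (hP : IsEwensPitmanProcess μ α θ P) (n : ℕ)
    (Φ : Finset (Finset ℕ) → Finset (Finset ℕ) → ℝ) :
    Integrable (fun ω => Φ (P n ω).parts (P (n + 1) ω).parts) μ :=
  memLp_one_iff_integrable.1 <|
    memLp_comp_of_finite (measurableSet_pair_eq (hP.measurableSet_eq n)
      (hP.measurableSet_eq (n + 1))) (fun π => Φ π.1.parts π.2.parts) 1

lemma setIntegral_next (hP : IsEwensPitmanProcess μ α θ P) {n : ℕ} (hn : 1 ≤ n)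
    (hθ : (n : ℝ) + θ ≠ 0) (π : Finpartition (Finset.Icc 1 n))
    (Φ : Finset (Finset ℕ) → Finset (Finset ℕ) → ℝ) :
    ∫ ω in {ω | P n ω = π}, Φ (P n ω).parts (P (n + 1) ω).parts ∂μ
      = ∫ ω in {ω | P n ω = π}, expNext α θ n (Φ (P n ω).parts) (P n ω).parts ∂μ := by
  have hR : ∫ ω in {ω | P n ω = π}, expNext α θ n (Φ (P n ω).parts) (P n ω).parts ∂μ
      = μ.real {ω | P n ω = π} * expNext α θ n (Φ π.parts) π.parts := by
    rw [setIntegral_congr_fun (g := fun _ => expNext α θ n (Φ π.parts) π.parts)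
      (hP.measurableSet_eq n π) (fun ω hω => by
        have h : P n ω = π := hω
        simp only [h]), setIntegral_const, smul_eq_mul]
  rw [hR, ← sum_nextParts hP hn, ← setIntegral_congr_set (biUnion_next_ae_eq hP hn hθ π),
    integral_biUnion_finset _ (fun T _ => measurableSet_next hP n π T)
      (pairwiseDisjoint_next n π _)
      (fun T _ => (integrable_comp_parts_succ hP n Φ).integrableOn)]
  refine Finset.sum_congr rfl fun T _ => ?_
  rw [setIntegral_congr_fun (g := fun _ => Φ π.parts T)
    (measurableSet_next hP n π T) (fun ω hω => by
      simp only [hω.1, hω.2]), setIntegral_const, smul_eq_mul]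

/-- Conditional expectations of functions of two successive partitions. -/
lemma condExp_comp_parts_succ (hP : IsEwensPitmanProcess μ α θ P) {n : ℕ} (hn : 1 ≤ n)
    (hθ : (n : ℝ) + θ ≠ 0) {m : MeasurableSpace Ω} (hm : m ≤ mΩ)
    (hmn : m ≤ eventuallyMeasurableSpace (MeasurableSpace.comap (P n) ⊤) (ae μ))
    (Φ : Finset (Finset ℕ) → Finset (Finset ℕ) → ℝ)
    (hΦ : StronglyMeasurable[m] fun ω => expNext α θ n (Φ (P n ω).parts) (P n ω).parts) :
    μ[fun ω => Φ (P n ω).parts (P (n + 1) ω).parts | m]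
      =ᵐ[μ] fun ω => expNext α θ n (Φ (P n ω).parts) (P n ω).parts := by
  have hint : Integrable (fun ω => expNext α θ n (Φ (P n ω).parts) (P n ω).parts) μ :=
    integrable_comp_parts hP n fun T => expNext α θ n (Φ T) T
  refine (ae_eq_condExp_of_forall_setIntegral_eq hm (integrable_comp_parts_succ hP n Φ)
    (fun s _ _ => hint.integrableOn) (fun s hs _ => ?_) hΦ.aestronglyMeasurable).symm
  -- Up to a null set, `s` is a finite union of atoms `{P n = π}`, on which the one-step law
  -- applies.
  obtain ⟨t, ⟨B, -, rfl⟩, hst⟩ := hmn s hs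
  have hB : P n ⁻¹' B = ⋃ π ∈ (Set.toFinite B).toFinset, {ω | P n ω = π} := by
    ext ω
    simp
  have hdisj : ((Set.toFinite B).toFinset : Set (Finpartition (Finset.Icc 1 n))).PairwiseDisjoint
      fun π => {ω | P n ω = π} := fun _ _ _ _ hne =>
    Set.disjoint_left.2 fun _ h1 h2 => hne (Eq.trans (Eq.symm h1) h2)
  rw [setIntegral_congr_set hst, setIntegral_congr_set hst, hB,
    integral_biUnion_finset _ (fun π _ => hP.measurableSet_eq n π) hdisj
      (fun _ _ => hint.integrableOn),
    integral_biUnion_finset _ (fun π _ => hP.measurableSet_eq n π) hdisj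
      (fun _ _ => (integrable_comp_parts_succ hP n Φ).integrableOn)]
  exact Finset.sum_congr rfl fun π _ => (setIntegral_next hP hn hθ π Φ).symm

end OneStep

/-! ### The statistic under the transition operator -/

/-- The statistic `∑_{i=1}^r b_{r,i} K_i + (-1)^r p_α(r) K + (-1)^r p_α(r) θ / α` of the blocks of a
partition. -/
def blockStat (α θ : ℝ) (r : ℕ) (T : Finset (Finset ℕ)) : ℝ :=
  (∑ i ∈ Finset.Icc 1 r, coeffB α r i * (sizeCount i T : ℝ))
    + coeffK α r * (T.card : ℝ) + coeffK α r * θ / α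

/-- The conditional second moment of the increment of `blockStat`. -/
def incSq (α θ : ℝ) (r n : ℕ) (T : Finset (Finset ℕ)) : ℝ :=
  (∑ i ∈ Finset.Icc 1 r,
      (sizeCount i T : ℝ) * (((i : ℝ) - α) * (extCoeffB α r (i + 1) - extCoeffB α r i) ^ 2)
    + (α * (T.card : ℝ) + θ) * (extCoeffB α r 1 + coeffK α r) ^ 2) / ((n : ℝ) + θ)

section Functionals

variable {n : ℕ} (π : Finpartition (Finset.Icc 1 n)) {α θ : ℝ}

lemma blockStat_attachParts (r : ℕ) {A : Finset ℕ} (hA : A ∈ π.parts) :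
    blockStat α θ r (attachParts n π.parts A) = blockStat α θ r π.parts
      + (extCoeffB α r (A.card + 1) - extCoeffB α r A.card) := by
  simp only [blockStat, card_attachParts π hA, sizeCount_attachParts π hA, mul_sub, mul_add,
    Finset.sum_sub_distrib, Finset.sum_add_distrib, mul_ite, mul_one, mul_zero, Finset.sum_ite_eq,
    extCoeffB]
  ring

lemma blockStat_newParts (r : ℕ) :
    blockStat α θ r (newParts n π.parts) = blockStat α θ r π.parts
      + (extCoeffB α r 1 + coeffK α r) := by
  simp only [blockStat, card_newParts π, sizeCount_newParts π, mul_add, Finset.sum_add_distrib,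
    mul_ite, mul_one, mul_zero, Finset.sum_ite_eq', extCoeffB, Nat.cast_add, Nat.cast_one]
  ring

lemma expNext_linear (hn : (n : ℝ) + θ ≠ 0) (Φ Ψ : Finset (Finset ℕ) → ℝ) (a b c : ℝ) :
    expNext α θ n (fun T => a * Φ T + b * Ψ T + c) π.parts
      = a * expNext α θ n Φ π.parts + b * expNext α θ n Ψ π.parts + c := by
  conv_rhs => rw [← expNext_const (α := α) π hn c]
  simp only [expNext, mul_add, Finset.mul_sum, Finset.sum_add_distrib]
  have e : ∀ (d : ℝ) (Φ : Finset (Finset ℕ) → ℝ),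
      ∑ A ∈ π.parts, ((A.card : ℝ) - α) / (n + θ) * (d * Φ (attachParts n π.parts A))
        = ∑ A ∈ π.parts, d * (((A.card : ℝ) - α) / (n + θ) * Φ (attachParts n π.parts A)) :=
    fun d Φ => Finset.sum_congr rfl fun A _ => by ring
  rw [e, e]
  ring

lemma expNext_card (f : ℕ → ℝ) :
    expNext α θ n (fun T => f T.card) π.parts
      = ((n - α * π.parts.card) * f π.parts.card
        + (α * π.parts.card + θ) * f (π.parts.card + 1)) / (n + θ) := by
  rw [expNext, Finset.sum_congr rfl (g := fun A =>
    ((A.card : ℝ) - α) / (n + θ) * f π.parts.card)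
    (fun A hA => by rw [card_attachParts π hA]), ← Finset.sum_mul, ← Finset.sum_div, sum_card_sub,
    card_newParts]
  ring

lemma expNext_card_add (hα : α ≠ 0) (hn : (n : ℝ) + θ ≠ 0) :
    expNext α θ n (fun T => (T.card : ℝ) + θ / α) π.parts
      = ((π.parts.card : ℝ) + θ / α) * (1 + α / (n + θ)) := by
  rw [expNext_card π (fun k => (k : ℝ) + θ / α)]
  push_cast
  field_simp
  ring

/-- By the two eigenvector relations the mean jump is `(α - r)/(n + θ)` times the statistic. The
additive constant absorbs the `θ` in the new-block probability. -/
lemma expNext_blockStat (hα : α ≠ 0) (hn : (n : ℝ) + θ ≠ 0) {r : ℕ} (hr : 1 ≤ r) :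
    expNext α θ n (blockStat α θ r) π.parts
      = blockStat α θ r π.parts * (1 + (α - r) / (n + θ)) := by
  set X := blockStat α θ r π.parts with hX
  have h1 : ∑ A ∈ π.parts, ((A.card : ℝ) - α) / (n + θ) * blockStat α θ r (attachParts n π.parts A)
      = (n - α * π.parts.card) / (n + θ) * X + ((α - r) / (n + θ))
        * ∑ i ∈ Finset.Icc 1 r, (sizeCount i π.parts : ℝ) * extCoeffB α r i := by
    rw [← sum_parts_eq_sum_sizeCount π r (extCoeffB α r) fun i hi => extCoeffB_of_lt hi,
      ← sum_card_sub, Finset.sum_div, Finset.sum_mul, Finset.mul_sum, ← Finset.sum_add_distrib]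
    refine Finset.sum_congr rfl fun A hA => ?_
    rw [blockStat_attachParts π r hA, mul_add, ← hX]
    congr 1
    rw [div_mul_eq_mul_div, extCoeffB_succ_sub α (block_card_pos π hA)]
    ring
  have h2 := coeffB_one_add_coeffK α hr
  have h3 : X = ∑ i ∈ Finset.Icc 1 r, (sizeCount i π.parts : ℝ) * extCoeffB α r i
      + coeffK α r * π.parts.card + coeffK α r * θ / α := by
    rw [hX, blockStat]
    congr 2
    exact Finset.sum_congr rfl fun i hi => by rw [extCoeffB_of_mem hi, mul_comm]
  set Y := ∑ i ∈ Finset.Icc 1 r, (sizeCount i π.parts : ℝ) * extCoeffB α r i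
  have h4 : extCoeffB α r 1 = (α - r) * coeffK α r / α - coeffK α r := by
    rw [← h2]; field_simp; ring
  rw [expNext, h1, blockStat_newParts, ← hX, h4, eq_sub_of_add_eq (eq_sub_of_add_eq h3.symm)]
  field_simp
  ring

lemma expNext_sq_sub (r : ℕ) :
    expNext α θ n (fun T => (blockStat α θ r T - blockStat α θ r π.parts) ^ 2) π.parts
      = incSq α θ r n π.parts := by
  rw [incSq, ← sum_parts_eq_sum_sizeCount π r
    (fun i => ((i : ℝ) - α) * (extCoeffB α r (i + 1) - extCoeffB α r i) ^ 2)
    (fun i hi => by simp [extCoeffB_of_lt hi, extCoeffB_of_lt (hi.trans (Nat.lt_succ_self i))]),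
    expNext, blockStat_newParts]
  conv_rhs => rw [add_div, Finset.sum_div]
  congr 1
  · refine Finset.sum_congr rfl fun A hA => ?_
    rw [blockStat_attachParts π r hA]
    ring
  · ring

lemma expNext_blockStat_sq (hα : α ≠ 0) (hn : (n : ℝ) + θ ≠ 0) {r : ℕ} (hr : 1 ≤ r) :
    expNext α θ n (fun T => blockStat α θ r T ^ 2) π.parts
      = blockStat α θ r π.parts ^ 2 * (1 + 2 * (α - r) / (n + θ)) + incSq α θ r n π.parts := by
  have h := expNext_linear π (α := α) hn
    (fun T => (blockStat α θ r T - blockStat α θ r π.parts) ^ 2) (blockStat α θ r)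
    1 (2 * blockStat α θ r π.parts) (-blockStat α θ r π.parts ^ 2)
  rw [expNext_sq_sub, expNext_blockStat π hα hn hr] at h
  rw [show (fun T => blockStat α θ r T ^ 2) = fun T =>
    1 * (blockStat α θ r T - blockStat α θ r π.parts) ^ 2
      + 2 * blockStat α θ r π.parts * blockStat α θ r T + -blockStat α θ r π.parts ^ 2 by
    funext T; ring, h]
  ring

/-- The conditional variance of the increment of a weighted process. -/
lemma expNext_weighted_sq_sub (hα : α ≠ 0) (hn : (n : ℝ) + θ ≠ 0) {r : ℕ} (hr : 1 ≤ r)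
    (w : ℝ) :
    expNext α θ n (fun T => (w * blockStat α θ r T
        - w * (1 + (α - r) / (n + θ)) * blockStat α θ r π.parts) ^ 2) π.parts
      = w ^ 2 * (incSq α θ r n π.parts
        - (blockStat α θ r π.parts * ((α - r) / (n + θ))) ^ 2) := by
  have h := expNext_linear π (α := α) hn (fun T => blockStat α θ r T ^ 2) (blockStat α θ r)
    (w ^ 2) (-(2 * w ^ 2 * (1 + (α - r) / (n + θ)) * blockStat α θ r π.parts))
    ((w * (1 + (α - r) / (n + θ)) * blockStat α θ r π.parts) ^ 2)
  rw [expNext_blockStat_sq π hα hn hr, expNext_blockStat π hα hn hr] at h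
  rw [show (fun T => (w * blockStat α θ r T
        - w * (1 + (α - r) / (n + θ)) * blockStat α θ r π.parts) ^ 2) = fun T =>
      w ^ 2 * blockStat α θ r T ^ 2
      + -(2 * w ^ 2 * (1 + (α - r) / (n + θ)) * blockStat α θ r π.parts) * blockStat α θ r T
      + (w * (1 + (α - r) / (n + θ)) * blockStat α θ r π.parts) ^ 2 by
    funext T; ring, h]
  ring

lemma one_le_card_parts (hn : 1 ≤ n) : 1 ≤ π.parts.card :=
  Finset.card_pos.2 (π.parts_nonempty (by simp; omega))

/-- The bound uses `K + θ / α`, itself an eigenfunction, so that it can serve as a compensator in a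
supermartingale. -/
lemma exists_incSq_le (hα0 : 0 < α) (hα1 : α < 1) (hθ : 0 < α + θ) (r : ℕ) :
    ∃ C, 0 ≤ C ∧ ∀ n : ℕ, 1 ≤ n → ∀ π : Finpartition (Finset.Icc 1 n),
      incSq α θ r n π.parts ≤ C * ((π.parts.card : ℝ) + θ / α) / (n + θ) := by
  set t := θ / α with ht
  have hθt : θ = α * t := by rw [ht]; field_simp
  have ht1 : 0 < 1 + t := by rw [hθt] at hθ; nlinarith
  set d : ℕ → ℝ := fun i => ((i : ℝ) - α) * (extCoeffB α r (i + 1) - extCoeffB α r i) ^ 2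
  have hd : ∀ i ∈ Finset.Icc 1 r, 0 ≤ d i := fun i hi => by
    have : (1 : ℝ) ≤ i := by exact_mod_cast (Finset.mem_Icc.1 hi).1
    exact mul_nonneg (by linarith) (sq_nonneg _)
  have hD : 0 ≤ 1 + |t| / (1 + t) := add_nonneg zero_le_one (div_nonneg (abs_nonneg _) ht1.le)
  refine ⟨(1 + |t| / (1 + t)) * ∑ i ∈ Finset.Icc 1 r, d i
    + α * (extCoeffB α r 1 + coeffK α r) ^ 2,
    add_nonneg (mul_nonneg hD (Finset.sum_nonneg hd)) (mul_nonneg hα0.le (sq_nonneg _)),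
    fun n hn π => ?_⟩
  have hn' : (1 : ℝ) ≤ n := by exact_mod_cast hn
  have hk : (1 : ℝ) ≤ π.parts.card := by exact_mod_cast one_le_card_parts π hn
  -- `t` may be negative, but `t > -1` and `K ≥ 1` give `K + t ≥ 1 + t > 0`.
  have hkD : (π.parts.card : ℝ) ≤ (1 + |t| / (1 + t)) * (π.parts.card + t) := by
    have h1 : |t| ≤ |t| / (1 + t) * (π.parts.card + t) := by
      rw [div_mul_eq_mul_div, le_div_iff₀ ht1]
      exact mul_le_mul_of_nonneg_left (by linarith) (abs_nonneg _)
    nlinarith [neg_abs_le t]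
  have hsum : ∑ i ∈ Finset.Icc 1 r, (sizeCount i π.parts : ℝ) * d i
      ≤ (1 + |t| / (1 + t)) * (π.parts.card + t) * ∑ i ∈ Finset.Icc 1 r, d i := by
    rw [Finset.mul_sum]
    refine Finset.sum_le_sum fun i hi => mul_le_mul_of_nonneg_right ?_ (hd i hi)
    exact le_trans (by exact_mod_cast sizeCount_le i π.parts) hkD
  rw [incSq]
  refine div_le_div_of_nonneg_right ?_ (by linarith)
  have : (α * (π.parts.card : ℝ) + θ) = α * (π.parts.card + t) := by rw [hθt]; ring
  rw [this]
  linarith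

end Functionals

/-! ### Martingales and supermartingales of the chain -/

section Martingales

variable {Ω : Type*} {mΩ : MeasurableSpace Ω} {μ : Measure Ω} {α θ : ℝ}
  {P : (n : ℕ) → Ω → Finpartition (Finset.Icc 1 n)}

lemma measurable_blockStat (hP : IsEwensPitmanProcess μ α θ P) (r : ℕ) {n : ℕ} (hn : 1 ≤ n) :
    Measurable[blockFiltration hP.measurableSet_eq r n] fun ω =>
      blockStat α θ r (P n ω).parts := by
  refine Measurable.add_const (Measurable.add (Finset.measurable_fun_sum _ fun i hi => ?_) ?_) _
  · exact ((measurable_from_top (f := fun k : ℕ => (k : ℝ))).comp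
      (measurable_numBlocksOfSize hP hi hn)).const_mul _
  · exact ((measurable_from_top (f := fun k : ℕ => (k : ℝ))).comp
      (measurable_numBlocks hP r hn)).const_mul _

lemma measurable_comp_card (hP : IsEwensPitmanProcess μ α θ P) (r : ℕ) {n : ℕ} (hn : 1 ≤ n)
    (f : ℕ → ℝ) :
    Measurable[blockFiltration hP.measurableSet_eq r n] fun ω => f (P n ω).parts.card :=
  (measurable_from_top (f := f)).comp (measurable_numBlocks hP r hn)

lemma measurable_incSq (hP : IsEwensPitmanProcess μ α θ P) (r : ℕ) {n : ℕ} (hn : 1 ≤ n) :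
    Measurable[blockFiltration hP.measurableSet_eq r n] fun ω =>
      incSq α θ r n (P n ω).parts := by
  refine Measurable.div_const (Measurable.add (Finset.measurable_fun_sum _ fun i hi => ?_)
    (Measurable.mul_const ?_ _)) _
  · exact ((measurable_from_top (f := fun k : ℕ => (k : ℝ))).comp
      (measurable_numBlocksOfSize hP hi hn)).mul_const _
  · exact measurable_comp_card hP r hn fun k => α * (k : ℝ) + θ

variable [IsProbabilityMeasure μ]

lemma condExp_blockFiltration (hP : IsEwensPitmanProcess μ α θ P)
    (hθ : ∀ n : ℕ, 1 ≤ n → (n : ℝ) + θ ≠ 0) (r : ℕ) {n : ℕ} (hn : 1 ≤ n)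
    (Φ : Finset (Finset ℕ) → Finset (Finset ℕ) → ℝ)
    (hΦ : Measurable[blockFiltration hP.measurableSet_eq r n]
      fun ω => expNext α θ n (Φ (P n ω).parts) (P n ω).parts) :
    μ[fun ω => Φ (P n ω).parts (P (n + 1) ω).parts | blockFiltration hP.measurableSet_eq r n]
      =ᵐ[μ] fun ω => expNext α θ n (Φ (P n ω).parts) (P n ω).parts :=
  condExp_comp_parts_succ hP hn (hθ n hn) ((blockFiltration hP.measurableSet_eq r).le n)
    (blockFiltration_le_eventuallyMeasurableSpace hP hθ r n) Φ hΦ.stronglyMeasurable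

lemma martingale_of_expNext (hP : IsEwensPitmanProcess μ α θ P)
    (hθ : ∀ n : ℕ, 1 ≤ n → (n : ℝ) + θ ≠ 0) (r : ℕ) {s : ℕ} (hs : 1 ≤ s)
    (Ψ : ℕ → Finset (Finset ℕ) → ℝ)
    (hmeas : ∀ n, s ≤ n → Measurable[blockFiltration hP.measurableSet_eq r n]
      fun ω => Ψ n (P n ω).parts)
    (h : ∀ n, s ≤ n → ∀ π : Finpartition (Finset.Icc 1 n),
      expNext α θ n (Ψ (n + 1)) π.parts = Ψ n π.parts) :
    Martingale (fun k ω => Ψ (s + k) (P (s + k) ω).parts)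
      (shiftFiltration (blockFiltration hP.measurableSet_eq r) s) μ := by
  refine martingale_nat (fun k => (hmeas (s + k) (by omega)).stronglyMeasurable)
    (fun k => integrable_comp_parts hP _ _) fun k => ?_
  have h1 := condExp_blockFiltration hP hθ r (n := s + k) (by omega) (fun _ => Ψ (s + k + 1)) (by
    simpa only [h (s + k) (by omega)] using hmeas (s + k) (by omega))
  refine EventuallyEq.trans (ae_of_all _ fun ω => ?_) h1.symm
  exact (h (s + k) (by omega) (P (s + k) ω)).symm

/-- A non-negative function of the chain which decreases on average converges almost surely. -/
lemma exists_ae_tendsto_of_expNext_le (hP : IsEwensPitmanProcess μ α θ P)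
    (hθ : ∀ n : ℕ, 1 ≤ n → (n : ℝ) + θ ≠ 0) (r : ℕ) (Ψ : ℕ → Finset (Finset ℕ) → ℝ)
    (hmeas : ∀ n, 1 ≤ n → Measurable[blockFiltration hP.measurableSet_eq r n]
      fun ω => Ψ n (P n ω).parts)
    (hmeas' : ∀ n, 1 ≤ n → Measurable[blockFiltration hP.measurableSet_eq r n]
      fun ω => expNext α θ n (Ψ (n + 1)) (P n ω).parts)
    (h0 : ∀ n, 1 ≤ n → ∀ π : Finpartition (Finset.Icc 1 n), 0 ≤ Ψ n π.parts)
    (h : ∀ n, 1 ≤ n → ∀ π : Finpartition (Finset.Icc 1 n),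
      expNext α θ n (Ψ (n + 1)) π.parts ≤ Ψ n π.parts) :
    ∃ g : Ω → ℝ, Measurable g ∧
      ∀ᵐ ω ∂μ, Tendsto (fun n => Ψ n (P n ω).parts) atTop (𝓝 (g ω)) := by
  set ℱ := shiftFiltration (blockFiltration hP.measurableSet_eq r) 1
  have hsuper : Supermartingale (fun k ω => Ψ (1 + k) (P (1 + k) ω).parts) ℱ μ := by
    refine supermartingale_nat (fun k => (hmeas (1 + k) (by omega)).stronglyMeasurable)
      (fun k => integrable_comp_parts hP _ _) fun k => ?_
    have h1 := condExp_blockFiltration hP hθ r (n := 1 + k) (by omega) (fun _ => Ψ (1 + k + 1))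
      (hmeas' (1 + k) (by omega))
    refine h1.le.trans (ae_of_all _ fun ω => ?_)
    exact h (1 + k) (by omega) (P (1 + k) ω)
  -- For a nonnegative supermartingale the `L¹` norm is the mean, bounded by its initial value;
  -- negation gives an `L¹`-bounded submartingale.
  have hbdd : ∀ k, eLpNorm ((-fun k ω => Ψ (1 + k) (P (1 + k) ω).parts : ℕ → Ω → ℝ) k) 1 μ
      ≤ (Real.toNNReal (∫ ω, Ψ (1 + 0) (P (1 + 0) ω).parts ∂μ) : ENNReal) := by
    intro k
    rw [Pi.neg_apply, eLpNorm_neg, eLpNorm_one_eq_lintegral_enorm,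
      ← ofReal_integral_norm_eq_lintegral_enorm (hsuper.integrable k)]
    refine ENNReal.ofReal_le_ofReal ?_
    rw [integral_congr_ae (ae_of_all _ fun ω => Real.norm_of_nonneg
      (h0 (1 + k) (by omega) (P (1 + k) ω)))]
    simpa using hsuper.setIntegral_le (Nat.zero_le k) MeasurableSet.univ
  obtain ⟨g, hg, hlim⟩ : ∃ g : Ω → ℝ, StronglyMeasurable[⨆ n, ℱ n] g ∧ ∀ᵐ ω ∂μ,
      Tendsto (fun k => (-fun k ω => Ψ (1 + k) (P (1 + k) ω).parts : ℕ → Ω → ℝ) k ω) atTop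
        (𝓝 (g ω)) :=
    ⟨_, Filtration.stronglyMeasurable_limitProcess, hsuper.neg.ae_tendsto_limitProcess hbdd⟩
  refine ⟨-g, (hg.measurable.mono (iSup_le fun n => ℱ.le n) le_rfl).neg, ?_⟩
  filter_upwards [hlim] with ω hω
  rw [← tendsto_add_atTop_iff_nat 1]
  refine hω.neg.congr fun n => ?_
  rw [Pi.neg_apply, Pi.neg_apply, neg_neg, Nat.add_comm 1 n]

end Martingales

/-! ### Almost sure limits of the block counts -/

section Limits

variable {Ω : Type*} {mΩ : MeasurableSpace Ω} {μ : Measure Ω} {α θ : ℝ}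
  {P : (n : ℕ) → Ω → Finpartition (Finset.Icc 1 n)}

lemma natCast_add_pos {α θ : ℝ} (hα1 : α < 1) (hθ : 0 < α + θ) {n : ℕ} (hn : 1 ≤ n) :
    0 < (n : ℝ) + θ := by
  have : (1 : ℝ) ≤ n := by exact_mod_cast hn
  linarith

lemma tendsto_natCast_rpow_atTop {c : ℝ} (hc : 0 < c) :
    Tendsto (fun n : ℕ => (n : ℝ) ^ c) atTop atTop :=
  (tendsto_rpow_atTop hc).comp tendsto_natCast_atTop_atTop

lemma tendsto_prodRatio_add {θ c : ℝ} (hθ : 0 < 1 + θ) :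
    Tendsto (fun n : ℕ => prodRatio θ (θ + c) 1 n * (n : ℝ) ^ c) atTop
      (𝓝 (Real.Gamma (1 + (θ + c)) / Real.Gamma (1 + θ))) := by
  have h := tendsto_prodRatio θ (θ + c) 1 (by simpa using (Real.Gamma_pos_of_pos hθ).ne')
  simpa using h

variable [IsProbabilityMeasure μ]

/-- The number of blocks, divided by `n ^ α`, converges almost surely. -/
lemma exists_ae_tendsto_numBlocks (hα0 : 0 < α) (hα1 : α < 1) (hθ : 0 < α + θ)
    (hP : IsEwensPitmanProcess μ α θ P) :
    ∃ S : Ω → ℝ, Measurable S ∧ ∀ᵐ ω ∂μ,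
      Tendsto (fun n : ℕ => (numBlocks P n ω : ℝ) / (n : ℝ) ^ α) atTop (𝓝 (S ω)) := by
  have hθ' : ∀ n : ℕ, 1 ≤ n → (n : ℝ) + θ ≠ 0 := fun n hn => (natCast_add_pos hα1 hθ hn).ne'
  have h1θ : 0 < 1 + θ := by linarith
  have hp := fun n => prodRatio_pos (s := 1) (a := θ) (b := θ + α) (by simpa using h1θ)
    (by push_cast; linarith) n
  have hstep : ∀ n, 1 ≤ n → ∀ π : Finpartition (Finset.Icc 1 n),
      expNext α θ n (fun T => prodRatio θ (θ + α) 1 (n + 1) * ((T.card : ℝ) + θ / α)) π.parts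
        = prodRatio θ (θ + α) 1 n * ((π.parts.card : ℝ) + θ / α) := by
    intro n hn π
    have h1 := expNext_linear π (α := α) (hθ' n hn) (fun T => (T.card : ℝ) + θ / α) (fun _ => 0)
      (prodRatio θ (θ + α) 1 (n + 1)) 0 0
    simp only [mul_zero, add_zero, zero_mul] at h1
    have h2 := natCast_add_pos hα1 hθ hn
    have h3 : (n : ℝ) + (θ + α) ≠ 0 := by linarith
    rw [h1, expNext_card_add π hα0.ne' (hθ' n hn), prodRatio_succ _ _ hn]
    field_simp
    ring
  obtain ⟨g, hg, hlim⟩ := exists_ae_tendsto_of_expNext_le hP hθ' 1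
    (fun n T => prodRatio θ (θ + α) 1 n * ((T.card : ℝ) + θ / α))
    (fun n hn => measurable_comp_card hP 1 hn fun k =>
      prodRatio θ (θ + α) 1 n * ((k : ℝ) + θ / α))
    (fun n hn => by
      simpa only [hstep n hn] using measurable_comp_card hP 1 hn fun k =>
        prodRatio θ (θ + α) 1 n * ((k : ℝ) + θ / α))
    (fun n hn π => by
      have hk : (1 : ℝ) ≤ π.parts.card := by exact_mod_cast one_le_card_parts π hn
      have : -1 < θ / α := by rw [lt_div_iff₀ hα0]; linarith
      exact mul_nonneg (hp n).le (by linarith))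
    (fun n hn π => (hstep n hn π).le)
  have hc := tendsto_prodRatio_add (c := α) h1θ
  have hc0 : Real.Gamma (1 + (θ + α)) / Real.Gamma (1 + θ) ≠ 0 :=
    (div_pos (Real.Gamma_pos_of_pos (by linarith)) (Real.Gamma_pos_of_pos h1θ)).ne'
  refine ⟨fun ω => g ω / (Real.Gamma (1 + (θ + α)) / Real.Gamma (1 + θ)), hg.div_const _, ?_⟩
  filter_upwards [hlim] with ω hω
  have h := (hω.div hc hc0).sub ((tendsto_natCast_rpow_atTop hα0).const_div_atTop (θ / α))
  rw [sub_zero] at h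
  refine h.congr' ?_
  filter_upwards [eventually_gt_atTop 0] with n hn
  have hn' : (n : ℝ) ^ α ≠ 0 := (Real.rpow_pos_of_pos (by exact_mod_cast hn) _).ne'
  have hp' := (hp n).ne'
  simp only [Pi.div_apply]
  rw [mul_div_mul_left _ _ hp', ← sub_div, add_sub_cancel_right]
  rfl

lemma exists_pos_le_of_tendsto {u : ℕ → ℝ} {L : ℝ} (hL : 0 < L) (hu : Tendsto u atTop (𝓝 L))
    (h0 : ∀ n, 1 ≤ n → 0 < u n) : ∃ c, 0 < c ∧ ∀ n, 1 ≤ n → c ≤ u n := by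
  obtain ⟨N, hN⟩ := eventually_atTop.1 (hu.eventually (lt_mem_nhds (half_lt_self hL)))
  have hne : (Finset.Icc 1 (N + 1)).Nonempty := ⟨1, by simp⟩
  refine ⟨min (L / 2) ((Finset.Icc 1 (N + 1)).inf' hne u), lt_min (half_pos hL) ?_, fun n hn => ?_⟩
  · rw [Finset.lt_inf'_iff]
    exact fun i hi => h0 i (Finset.mem_Icc.1 hi).1
  · rcases le_total N n with h | h
    · exact (min_le_left _ _).trans (hN n h).le
    · exact (min_le_right _ _).trans
        (Finset.inf'_le _ (Finset.mem_Icc.2 ⟨hn, h.trans (Nat.le_succ N)⟩))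

/-- The limit of the number of blocks, divided by `n ^ α`, is almost surely positive. -/
lemma ae_pos_of_tendsto_numBlocks (hα0 : 0 < α) (hα1 : α < 1) (hθ : 0 < α + θ)
    (hP : IsEwensPitmanProcess μ α θ P) {S : Ω → ℝ}
    (hS : ∀ᵐ ω ∂μ, Tendsto (fun n : ℕ => (numBlocks P n ω : ℝ) / (n : ℝ) ^ α) atTop (𝓝 (S ω))) :
    ∀ᵐ ω ∂μ, 0 < S ω := by
  have hθ' : ∀ n : ℕ, 1 ≤ n → (n : ℝ) + θ ≠ 0 := fun n hn => (natCast_add_pos hα1 hθ hn).ne'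
  set t := θ / α with ht
  have hθt : θ = α * t := by rw [ht]; field_simp
  have ht1 : 0 < 1 + t := by rw [hθt] at hθ; nlinarith
  -- Small enough that `1 + t - ε` and `1 + θ - α ε` stay positive, hence so do all factors of `p`
  -- and `f`.
  set ε := (1 + t) / 2 with hε
  have hε0 : 0 < ε := half_pos ht1
  have hαε : α * ε = (α + θ) / 2 := by rw [hε, hθt]; ring
  have h1θ : 0 < 1 + θ := by linarith
  have h2θ : 0 < 1 + (θ + -(α * ε)) := by rw [hαε]; linarith
  set p : ℕ → ℝ := prodRatio θ (θ + -(α * ε)) 1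
  -- `f k` decays like `k ^ (-ε)` and `f (k + 1) - f k = -ε f k / (k + t)`. The factor `k + t`
  -- cancels against the new-block probability `α (k + t)/(n + θ)`, so `f` of the block count is an
  -- exact eigenfunction and `p n * f K_n` a martingale.
  set f : ℕ → ℝ := prodRatio (t + -ε) t 1
  have hp : ∀ n, 0 < p n := fun n =>
    prodRatio_pos (by push_cast; exact h1θ) (by push_cast; exact h2θ) n
  have hf : ∀ n, 0 < f n := fun n =>
    prodRatio_pos (by push_cast; linarith) (by push_cast; exact ht1) n
  have hstep : ∀ n, 1 ≤ n → ∀ π : Finpartition (Finset.Icc 1 n),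
      expNext α θ n (fun T => p (n + 1) * f T.card) π.parts = p n * f π.parts.card := by
    intro n hn π
    have hk := one_le_card_parts π hn
    have hk' : (1 : ℝ) ≤ π.parts.card := by exact_mod_cast hk
    have hn' : (1 : ℝ) ≤ n := by exact_mod_cast hn
    rw [expNext_card π (fun k => p (n + 1) * f k)]
    simp only [p, f]
    rw [prodRatio_succ _ _ hn, prodRatio_succ _ _ hk]
    have h1 := hθ' n hn
    have h2 : (n : ℝ) + (θ + -(α * ε)) ≠ 0 := by linarith
    have h3 : (π.parts.card : ℝ) + t ≠ 0 := by linarith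
    have h4 : α * (π.parts.card : ℝ) + θ = α * (π.parts.card + t) := by rw [hθt]; ring
    rw [h4]
    field_simp
    rw [hθt]
    ring
  obtain ⟨g, -, hlim⟩ := exists_ae_tendsto_of_expNext_le hP hθ' 1 (fun n T => p n * f T.card)
    (fun n hn => measurable_comp_card hP 1 hn fun k => p n * f k)
    (fun n hn => by
      simpa only [hstep n hn] using measurable_comp_card hP 1 hn fun k => p n * f k)
    (fun n _ π => mul_nonneg (hp n).le (hf _).le) (fun n hn π => (hstep n hn π).le)
  have hpc := tendsto_prodRatio_add (c := -(α * ε)) h1θ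
  have hpc0 : 0 < Real.Gamma (1 + (θ + -(α * ε))) / Real.Gamma (1 + θ) :=
    div_pos (Real.Gamma_pos_of_pos h2θ) (Real.Gamma_pos_of_pos h1θ)
  have h1f : 0 < 1 + (t + -ε) := by linarith
  have hfc : Tendsto (fun k : ℕ => f k * (k : ℝ) ^ ε) atTop
      (𝓝 (Real.Gamma (1 + t) / Real.Gamma (1 + (t + -ε)))) := by
    have h := tendsto_prodRatio (t + -ε) t 1 (by simpa using (Real.Gamma_pos_of_pos h1f).ne')
    simpa using h
  obtain ⟨c, hc0, hc⟩ := exists_pos_le_of_tendsto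
    (div_pos (Real.Gamma_pos_of_pos ht1) (Real.Gamma_pos_of_pos h1f)) hfc
    (fun k hk => mul_pos (hf k) (Real.rpow_pos_of_pos (by exact_mod_cast hk) _))
  filter_upwards [hS, hlim] with ω h1 h2
  have hpos : ∀ᶠ n : ℕ in atTop, 0 < (numBlocks P n ω : ℝ) / (n : ℝ) ^ α := by
    filter_upwards [eventually_ge_atTop 1] with n hn
    exact div_pos (by exact_mod_cast one_le_card_parts (P n ω) hn)
      (Real.rpow_pos_of_pos (by exact_mod_cast hn) _)
  -- If `S ω = 0`, the convergent martingale, bounded below by a multiple of `(K_n / n ^ α) ^ (-ε)`,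
  -- would diverge.
  refine lt_of_le_of_ne (ge_of_tendsto h1 (hpos.mono fun _ h => h.le)) fun h0 => ?_
  rw [← h0] at h1
  have h3 : Tendsto (fun n : ℕ => ((numBlocks P n ω : ℝ) / (n : ℝ) ^ α) ^ (-ε)) atTop atTop :=
    (tendsto_rpow_neg_nhdsGT_zero (by linarith)).comp
      (tendsto_nhdsWithin_iff.2 ⟨h1, hpos⟩)
  have h4 := (h3.atTop_mul_pos hpc0 hpc).const_mul_atTop hc0
  refine not_tendsto_atTop_of_tendsto_nhds h2 (tendsto_atTop_mono' _ ?_ h4)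
  filter_upwards [eventually_ge_atTop 1, hpos] with n hn hposn
  have hn0 : (0 : ℝ) < n := by exact_mod_cast hn
  have hk := one_le_card_parts (P n ω) hn
  have hk0 : (0 : ℝ) < numBlocks P n ω := by exact_mod_cast hk
  have hcn := hc _ hk
  have e : ((numBlocks P n ω : ℝ) / (n : ℝ) ^ α) ^ (-ε) * (p n * (n : ℝ) ^ (-(α * ε)))
      = p n * ((numBlocks P n ω : ℝ) ^ ε)⁻¹ := by
    rw [Real.div_rpow hk0.le (Real.rpow_nonneg hn0.le _), ← Real.rpow_mul hn0.le,
      Real.rpow_neg hk0.le, show α * -ε = -(α * ε) by ring]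
    have : (n : ℝ) ^ (-(α * ε)) ≠ 0 := (Real.rpow_pos_of_pos hn0 _).ne'
    field_simp
  change c * (((numBlocks P n ω : ℝ) / (n : ℝ) ^ α) ^ (-ε) * (p n * (n : ℝ) ^ (-(α * ε))))
    ≤ p n * f (P n ω).parts.card
  rw [e, mul_left_comm]
  refine mul_le_mul_of_nonneg_left ?_ (hp n).le
  rw [← div_eq_mul_inv, div_le_iff₀ (Real.rpow_pos_of_pos hk0 _)]
  exact hcn

/-- The statistic `blockStat` is almost surely negligible with respect to `n ^ α`. -/
lemma ae_tendsto_blockStat (hα0 : 0 < α) (hα1 : α < 1) (hθ : 0 < α + θ)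
    (hP : IsEwensPitmanProcess μ α θ P) {r : ℕ} (hr : 1 ≤ r) :
    ∀ᵐ ω ∂μ, Tendsto (fun n : ℕ => blockStat α θ r (P n ω).parts / (n : ℝ) ^ α) atTop (𝓝 0) := by
  have hθ' : ∀ n : ℕ, 1 ≤ n → (n : ℝ) + θ ≠ 0 := fun n hn => (natCast_add_pos hα1 hθ hn).ne'
  have h1θ : 0 < 1 + θ := by linarith
  obtain ⟨C, hC0, hC⟩ := exists_incSq_le hα0 hα1 hθ r
  -- The compensator must satisfy `C + α C' = γ C'`. With `γ = 3α/2` this gives `C' = 2C/α`; `γ <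
  -- 2α` makes the square of the statistic `O(n ^ γ) = o(n ^ (2α))`.
  set C' := 2 * C / α with hC'
  have hCC : C = α / 2 * C' := by rw [hC']; field_simp
  have hC'0 : 0 ≤ C' := div_nonneg (by linarith) hα0.le
  set γ := 3 * α / 2 with hγ
  set v : ℕ → ℝ := prodRatio θ (θ + γ) 1
  have hv : ∀ n, 0 < v n := fun n =>
    prodRatio_pos (by push_cast; exact h1θ) (by push_cast; linarith) n
  have hr' : (1 : ℝ) ≤ r := by exact_mod_cast hr
  have ht : -1 < θ / α := by rw [lt_div_iff₀ hα0]; linarith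
  have hZ : ∀ n, 1 ≤ n → ∀ π : Finpartition (Finset.Icc 1 n),
      0 ≤ (π.parts.card : ℝ) + θ / α := fun n hn π => by
    have hk : (1 : ℝ) ≤ π.parts.card := by exact_mod_cast one_le_card_parts π hn
    linarith
  have hexp : ∀ n, 1 ≤ n → ∀ π : Finpartition (Finset.Icc 1 n),
      expNext α θ n (fun T => v (n + 1) * (blockStat α θ r T ^ 2 + C' * ((T.card : ℝ) + θ / α)))
          π.parts
        = v (n + 1) * ((blockStat α θ r π.parts ^ 2 * (1 + 2 * (α - r) / (n + θ))
            + incSq α θ r n π.parts)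
          + C' * (((π.parts.card : ℝ) + θ / α) * (1 + α / (n + θ)))) := by
    intro n hn π
    have h1 := expNext_linear π (α := α) (hθ' n hn) (fun T => blockStat α θ r T ^ 2)
      (fun T => (T.card : ℝ) + θ / α) (v (n + 1)) (v (n + 1) * C') 0
    rw [expNext_blockStat_sq π hα0.ne' (hθ' n hn) hr, expNext_card_add π hα0.ne' (hθ' n hn)] at h1
    simp only [add_zero] at h1
    simp only [mul_add, ← mul_assoc] at h1 ⊢
    exact h1
  obtain ⟨g, -, hlim⟩ := exists_ae_tendsto_of_expNext_le hP hθ' r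
    (fun n T => v n * (blockStat α θ r T ^ 2 + C' * ((T.card : ℝ) + θ / α)))
    (fun n hn => (((measurable_blockStat hP r hn).pow_const 2).add
      (measurable_comp_card hP r hn fun k => C' * ((k : ℝ) + θ / α))).const_mul _)
    (fun n hn => by
      simp only [hexp n hn]
      exact (((((measurable_blockStat hP r hn).pow_const 2).mul_const _).add
        (measurable_incSq hP r hn)).add
        (measurable_comp_card hP r hn fun k =>
          C' * (((k : ℝ) + θ / α) * (1 + α / (n + θ))))).const_mul _)
    (fun n hn π => mul_nonneg (hv n).le
      (add_nonneg (sq_nonneg _) (mul_nonneg hC'0 (hZ n hn π))))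
    (fun n hn π => by
      rw [hexp n hn]
      have hn0 := natCast_add_pos hα1 hθ hn
      have hn1 : 0 < (n : ℝ) + (θ + γ) := by linarith
      have hvs : v n = v (n + 1) * (1 + γ / (n + θ)) := by
        simp only [v]
        rw [prodRatio_succ _ _ hn]
        field_simp
        ring
      rw [hvs, mul_assoc]
      refine mul_le_mul_of_nonneg_left ?_ (hv _).le
      have h1 := hC n hn π
      set Z := (π.parts.card : ℝ) + θ / α
      have h2 : C * Z / (n + θ) + C' * (Z * (1 + α / (n + θ)))
          = (1 + γ / (n + θ)) * (C' * Z) := by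
        rw [hCC, hγ]; field_simp; ring
      have h3 : blockStat α θ r π.parts ^ 2 * (1 + 2 * (α - r) / (n + θ))
          ≤ (1 + γ / (n + θ)) * blockStat α θ r π.parts ^ 2 := by
        rw [mul_comm]
        refine mul_le_mul_of_nonneg_right ?_ (sq_nonneg _)
        have : 2 * (α - r) / (n + θ) ≤ γ / (n + θ) :=
          div_le_div_of_nonneg_right (by linarith) hn0.le
        linarith
      linarith)
  have hvc := tendsto_prodRatio_add (c := γ) h1θ
  have hvc0 : Real.Gamma (1 + (θ + γ)) / Real.Gamma (1 + θ) ≠ 0 :=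
    (div_pos (Real.Gamma_pos_of_pos (by linarith)) (Real.Gamma_pos_of_pos h1θ)).ne'
  filter_upwards [hlim] with ω hω
  have h1 := (hω.div hvc hvc0).mul
    ((tendsto_natCast_rpow_atTop (half_pos hα0)).const_div_atTop 1)
  rw [mul_zero] at h1
  have h2 : Tendsto (fun n : ℕ => (blockStat α θ r (P n ω).parts / (n : ℝ) ^ α) ^ 2) atTop
      (𝓝 0) := by
    refine squeeze_zero' (Eventually.of_forall fun n => sq_nonneg _) ?_ h1
    filter_upwards [eventually_ge_atTop 1] with n hn
    have hn0 : (0 : ℝ) < n := by exact_mod_cast hn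
    simp only [Pi.div_apply]
    rw [mul_div_mul_left _ _ (hv n).ne', div_mul_div_comm, mul_one, ← Real.rpow_add hn0, div_pow,
      ← Real.rpow_natCast, ← Real.rpow_natCast, ← Real.rpow_mul hn0.le]
    rw [show γ + α / 2 = α * (2 : ℕ) by rw [hγ]; push_cast; ring]
    refine div_le_div_of_nonneg_right ?_ (Real.rpow_nonneg hn0.le _)
    rw [Real.rpow_natCast]
    exact le_add_of_nonneg_right (mul_nonneg hC'0 (hZ n hn (P n ω)))
  have h3 := h2.sqrt
  simp only [Real.sqrt_zero, Real.sqrt_sq_eq_abs] at h3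
  exact (tendsto_zero_iff_abs_tendsto_zero _).2 h3

/-- If `K_n ~ S n ^ α` and every `blockStat` is negligible, then `K_{r,n} ~ p_α(r) S n ^ α`. -/
lemma tendsto_sizeCount_of_tendsto_blockStat (hα0 : 0 < α) {T : ℕ → Finset (Finset ℕ)} {S : ℝ}
    (hS : Tendsto (fun n : ℕ => ((T n).card : ℝ) / (n : ℝ) ^ α) atTop (𝓝 S))
    (hX : ∀ r : ℕ, 1 ≤ r →
      Tendsto (fun n : ℕ => blockStat α θ r (T n) / (n : ℝ) ^ α) atTop (𝓝 0))
    (r : ℕ) (hr : 1 ≤ r) :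
    Tendsto (fun n : ℕ => (sizeCount r (T n) : ℝ) / (n : ℝ) ^ α) atTop (𝓝 (sibuya α r * S)) := by
  induction r using Nat.strong_induction_on with
  | _ r ih =>
    obtain ⟨j, rfl⟩ : ∃ k, r = k + 1 := ⟨r - 1, by omega⟩
    have h1 : Tendsto (fun n : ℕ => ∑ i ∈ Finset.Icc 1 j,
        coeffB α (j + 1) i * ((sizeCount i (T n) : ℝ) / (n : ℝ) ^ α)) atTop
        (𝓝 (∑ i ∈ Finset.Icc 1 j, coeffB α (j + 1) i * (sibuya α i * S))) :=
      tendsto_finsetSum _ fun i hi =>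
        (ih i (by have := Finset.mem_Icc.1 hi; omega) (Finset.mem_Icc.1 hi).1).const_mul _
    -- Since `b_{r,r} = 1`, the statistic can be solved for its top count.
    have h2 := (((hX (j + 1) hr).sub h1).sub (hS.const_mul (coeffK α (j + 1)))).sub
      ((tendsto_natCast_rpow_atTop hα0).const_div_atTop (coeffK α (j + 1) * θ / α))
    have hlim : 0 - ∑ i ∈ Finset.Icc 1 j, coeffB α (j + 1) i * (sibuya α i * S)
        - coeffK α (j + 1) * S - 0 = sibuya α (j + 1) * S := by
      have h3 := sum_coeffB_mul_sibuya α hr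
      rw [Finset.sum_Icc_succ_top (by omega), coeffB_self] at h3
      simp only [← mul_assoc, ← Finset.sum_mul]
      linear_combination (-S) * h3
    rw [hlim] at h2
    refine h2.congr fun n => ?_
    rw [blockStat, Finset.sum_Icc_succ_top (by omega), coeffB_self]
    simp only [mul_div_assoc', ← Finset.sum_div]
    ring

end Limits

/-! ### Quadratic variation of the weighted processes -/

lemma tendsto_natCast_div_add (c : ℝ) :
    Tendsto (fun n : ℕ => (n : ℝ) / ((n : ℝ) + c)) atTop (𝓝 1) := by
  have h : Tendsto (fun n : ℕ => 1 + c / (n : ℝ)) atTop (𝓝 (1 + 0)) :=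
    tendsto_const_nhds.add (tendsto_const_div_atTop_nhds_zero_nat _)
  rw [add_zero] at h
  have h2 := h.inv₀ one_ne_zero
  rw [inv_one] at h2
  refine h2.congr' ?_
  filter_upwards [eventually_gt_atTop 0] with n hn
  have hn' : (n : ℝ) ≠ 0 := by exact_mod_cast hn.ne'
  rw [← inv_div]
  field_simp

section QuadraticVariation

variable {α θ : ℝ}

lemma tendsto_incSq {T : ℕ → Finset (Finset ℕ)} {S : ℝ} (hα0 : 0 < α) (r : ℕ)
    (hK : Tendsto (fun n : ℕ => ((T n).card : ℝ) / (n : ℝ) ^ α) atTop (𝓝 S))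
    (hKi : ∀ i, 1 ≤ i →
      Tendsto (fun n : ℕ => (sizeCount i (T n) : ℝ) / (n : ℝ) ^ α) atTop (𝓝 (sibuya α i * S))) :
    Tendsto (fun n : ℕ => incSq α θ r n (T n) / (n : ℝ) ^ (α - 1)) atTop
      (𝓝 (incrVar α r * S)) := by
  have h1 : Tendsto (fun n : ℕ => ∑ i ∈ Finset.Icc 1 r, (sizeCount i (T n) : ℝ) / (n : ℝ) ^ α
      * (((i : ℝ) - α) * (extCoeffB α r (i + 1) - extCoeffB α r i) ^ 2)) atTop
      (𝓝 (∑ i ∈ Finset.Icc 1 r, sibuya α i * S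
        * (((i : ℝ) - α) * (extCoeffB α r (i + 1) - extCoeffB α r i) ^ 2))) :=
    tendsto_finsetSum _ fun i hi => (hKi i (Finset.mem_Icc.1 hi).1).mul_const _
  have h2 := ((hK.const_mul α).add
    ((tendsto_natCast_rpow_atTop hα0).const_div_atTop θ)).mul_const
      ((extCoeffB α r 1 + coeffK α r) ^ 2)
  have h3 := (h1.add h2).mul (tendsto_natCast_div_add θ)
  have hlim : (∑ i ∈ Finset.Icc 1 r, sibuya α i * S
        * (((i : ℝ) - α) * (extCoeffB α r (i + 1) - extCoeffB α r i) ^ 2)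
      + (α * S + 0) * (extCoeffB α r 1 + coeffK α r) ^ 2) * 1 = incrVar α r * S := by
    rw [mul_one, add_zero, incrVar, add_mul (_ ^ 2 * α), Finset.sum_mul, add_comm]
    congr 1
    · ring
    · exact Finset.sum_congr rfl fun i _ => by ring
  rw [hlim] at h3
  refine h3.congr' ?_
  filter_upwards [eventually_gt_atTop 0] with n hn
  have hn0 : (0 : ℝ) < n := by exact_mod_cast hn
  have hp : (n : ℝ) ^ α ≠ 0 := (Real.rpow_pos_of_pos hn0 _).ne'
  have hs : ∑ i ∈ Finset.Icc 1 r, (sizeCount i (T n) : ℝ) / (n : ℝ) ^ α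
        * (((i : ℝ) - α) * (extCoeffB α r (i + 1) - extCoeffB α r i) ^ 2)
      = (∑ i ∈ Finset.Icc 1 r, (sizeCount i (T n) : ℝ)
        * (((i : ℝ) - α) * (extCoeffB α r (i + 1) - extCoeffB α r i) ^ 2)) / (n : ℝ) ^ α := by
    rw [Finset.sum_div]
    exact Finset.sum_congr rfl fun i _ => by ring
  rw [hs, incSq, Real.rpow_sub_one hn0.ne', div_div_div_eq, mul_comm ((n : ℝ) + θ),
    ← div_mul_div_comm]
  field_simp

variable {Ω : Type*} {mΩ : MeasurableSpace Ω} {μ : Measure Ω}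
  {P : (n : ℕ) → Ω → Finpartition (Finset.Icc 1 n)} [IsProbabilityMeasure μ]

/-- The weights undo the eigenvalue of the statistic. This needs a nonzero denominator at each
index, which is where the excluded values of `α + θ` enter. -/
lemma weight_step {r s n : ℕ} {w : ℕ → ℝ} (hα1 : α < 1) (hθ : 0 < α + θ) (hs : 1 ≤ s)
    (hb : ∀ k : ℕ, s ≤ k → (k : ℝ) + (α + θ - r) ≠ 0)
    (hw : ∀ n, s ≤ n → w n = prodRatio θ (α + θ - r) s n) (hn : s ≤ n) :
    w n = w (n + 1) * (1 + (α - r) / (n + θ)) := by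
  have h1 := (natCast_add_pos hα1 hθ (hs.trans hn)).ne'
  have h2 := hb n hn
  rw [hw n hn, hw (n + 1) (by omega), prodRatio_succ _ _ hn,
    show 1 + (α - r) / ((n : ℝ) + θ) = (n + (α + θ - r)) / (n + θ) by field_simp; ring,
    mul_assoc, div_mul_div_cancel₀ h2, div_self h1, mul_one]

lemma isSquareIntegrableMartingaleFrom_weightedProcess (hα0 : 0 < α) (hα1 : α < 1)
    (hθ : 0 < α + θ) (hP : IsEwensPitmanProcess μ α θ P) {r s : ℕ} (hr : 1 ≤ r) (hs : 1 ≤ s)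
    {w : ℕ → ℝ} (hw : ∀ n, s ≤ n → w n = w (n + 1) * (1 + (α - r) / (n + θ))) :
    IsSquareIntegrableMartingaleFrom s (weightedProcess α θ P r w)
      (blockFiltration hP.measurableSet_eq r) μ := by
  have hθ' : ∀ n : ℕ, 1 ≤ n → (n : ℝ) + θ ≠ 0 := fun n hn => (natCast_add_pos hα1 hθ hn).ne'
  refine ⟨martingale_of_expNext hP hθ' r hs (fun n T => w n * blockStat α θ r T)
    (fun n hn => (measurable_blockStat hP r (hs.trans hn)).const_mul _) fun n hn π => ?_,
    fun n _ => memLp_comp_parts hP n (fun T => w n * blockStat α θ r T) 2⟩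
  have hn1 := hθ' n (hs.trans hn)
  have h := expNext_linear π (α := α) hn1 (blockStat α θ r) (fun _ => 0) (w (n + 1)) 0 0
  simp only [mul_zero, add_zero, zero_mul] at h
  rw [h, expNext_blockStat π hα0.ne' hn1 hr, hw n hn]
  ring

lemma condExp_weightedProcess_sq (hα0 : 0 < α) (hα1 : α < 1)
    (hθ : 0 < α + θ) (hP : IsEwensPitmanProcess μ α θ P) {r s : ℕ} (hr : 1 ≤ r) (hs : 1 ≤ s)
    {w : ℕ → ℝ} (hw : ∀ n, s ≤ n → w n = w (n + 1) * (1 + (α - r) / (n + θ))) {n : ℕ}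
    (hn : s ≤ n) :
    μ[fun ω => (weightedProcess α θ P r w (n + 1) ω - weightedProcess α θ P r w n ω) ^ 2
        | blockFiltration hP.measurableSet_eq r n]
      =ᵐ[μ] fun ω => w (n + 1) ^ 2 * (incSq α θ r n (P n ω).parts
        - (blockStat α θ r (P n ω).parts * ((α - r) / (n + θ))) ^ 2) := by
  have hθ' : ∀ n : ℕ, 1 ≤ n → (n : ℝ) + θ ≠ 0 := fun n hn => (natCast_add_pos hα1 hθ hn).ne'
  have hn1 := hs.trans hn
  have hE : ∀ π : Finpartition (Finset.Icc 1 n),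
      expNext α θ n (fun T' => (w (n + 1) * blockStat α θ r T'
        - w n * blockStat α θ r π.parts) ^ 2) π.parts
      = w (n + 1) ^ 2 * (incSq α θ r n π.parts
        - (blockStat α θ r π.parts * ((α - r) / (n + θ))) ^ 2) := fun π => by
    rw [hw n hn]
    exact expNext_weighted_sq_sub π hα0.ne' (hθ' n hn1) hr _
  have h := condExp_blockFiltration hP hθ' r hn1
    (fun T T' => (w (n + 1) * blockStat α θ r T' - w n * blockStat α θ r T) ^ 2) (by
      simp only [hE]
      exact ((measurable_incSq hP r hn1).sub
        (((measurable_blockStat hP r hn1).mul_const _).pow_const 2)).const_mul _)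
  simp only [hE] at h
  exact h

/-- Almost sure asymptotics of the predictable quadratic variation. -/
lemma ae_tendsto_predQuadVarFrom (hα0 : 0 < α) (hα1 : α < 1)
    (hθ : 0 < α + θ) (hP : IsEwensPitmanProcess μ α θ P) {r s : ℕ} (hr : 1 ≤ r) (hs : 1 ≤ s)
    (hb : ∀ k : ℕ, s ≤ k → (k : ℝ) + (α + θ - r) ≠ 0)
    {w : ℕ → ℝ} (hw : ∀ n, s ≤ n → w n = prodRatio θ (α + θ - r) s n) {S : Ω → ℝ}
    (hS : ∀ᵐ ω ∂μ, Tendsto (fun n : ℕ => (numBlocks P n ω : ℝ) / (n : ℝ) ^ α) atTop (𝓝 (S ω))) :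
    ∀ᵐ ω ∂μ, Tendsto (fun n : ℕ => predQuadVarFrom s (weightedProcess α θ P r w)
        (blockFiltration hP.measurableSet_eq r) μ n ω / (n : ℝ) ^ (2 * (r : ℝ) - α)) atTop
      (𝓝 (sibuya α r * (rising ((r : ℝ) - α) r / (r.factorial : ℝ))
        * (Real.Gamma (s + (α + θ - r)) / Real.Gamma (s + θ)) ^ 2 * S ω)) := by
  have hr' : (1 : ℝ) ≤ r := by exact_mod_cast hr
  have hw' := fun n (hn : s ≤ n) => weight_step hα1 hθ hs hb hw hn
  have hX : ∀ᵐ ω ∂μ, ∀ r : ℕ, 1 ≤ r →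
      Tendsto (fun n : ℕ => blockStat α θ r (P n ω).parts / (n : ℝ) ^ α) atTop (𝓝 0) :=
    ae_all_iff.2 fun r => by
      by_cases h : 1 ≤ r
      · filter_upwards [ae_tendsto_blockStat hα0 hα1 hθ hP h] with ω hω _ using hω
      · exact ae_of_all _ fun ω h' => absurd h' h
  have hV : ∀ᵐ ω ∂μ, ∀ n : ℕ, s ≤ n →
      (μ[fun ω => (weightedProcess α θ P r w (n + 1) ω - weightedProcess α θ P r w n ω) ^ 2
        | blockFiltration hP.measurableSet_eq r n]) ω
      = w (n + 1) ^ 2 * (incSq α θ r n (P n ω).parts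
        - (blockStat α θ r (P n ω).parts * ((α - r) / (n + θ))) ^ 2) :=
    ae_all_iff.2 fun n => by
      by_cases h : s ≤ n
      · filter_upwards [condExp_weightedProcess_sq hα0 hα1 hθ hP hr hs hw' h] with ω hω _ using hω
      · exact ae_of_all _ fun ω h' => absurd h' h
  have hsθ := natCast_add_pos hα1 hθ hs
  have hwlim : Tendsto (fun n : ℕ => w (n + 1) * (n : ℝ) ^ (α - r)) atTop
      (𝓝 (Real.Gamma (s + (α + θ - r)) / Real.Gamma (s + θ))) := by
    have h := ((tendsto_prodRatio θ (α + θ - r) s (Real.Gamma_pos_of_pos hsθ).ne').mul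
      (tendsto_natCast_div_add (α + θ - r))).div (tendsto_natCast_div_add θ) one_ne_zero
    rw [mul_one, div_one] at h
    refine h.congr' ?_
    filter_upwards [eventually_ge_atTop s] with n hn
    have hn0 : (n : ℝ) ≠ 0 := by exact_mod_cast (by omega : n ≠ 0)
    have h1 := hb n hn
    have h2 := (natCast_add_pos hα1 hθ (hs.trans hn)).ne'
    simp only [Pi.div_apply]
    rw [hw (n + 1) (by omega), prodRatio_succ _ _ hn, show α + θ - r - θ = α - (r : ℝ) by ring]
    field_simp
  filter_upwards [hS, hX, hV] with ω h1 h2 h3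
  have h4 := tendsto_sizeCount_of_tendsto_blockStat hα0 h1 h2
  have h5 := tendsto_incSq (θ := θ) hα0 r h1 h4
  -- The squared drift is `o(n ^ (2α - 2))`, negligible against `n ^ (α - 1)` because `α < 1`.
  have h6 := (((h2 r hr).mul (tendsto_natCast_div_add θ)).mul_const (α - r)).pow 2 |>.mul
    ((tendsto_natCast_rpow_atTop (sub_pos.2 hα1)).const_div_atTop 1)
  rw [mul_zero] at h6
  have h7 := (hwlim.pow 2).mul (h5.sub h6)
  rw [sub_zero] at h7
  have hβ : 0 < 2 * (r : ℝ) - α := by linarith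
  have h8 := tendsto_sum_Ico_div_rpow hβ (u := fun n => w (n + 1) ^ 2
    * (incSq α θ r n (P n ω).parts
        - (blockStat α θ r (P n ω).parts * ((α - r) / (n + θ))) ^ 2)) s (h7.congr' (by
      filter_upwards [eventually_ge_atTop s] with n hn
      have hn0 : (0 : ℝ) < n := by exact_mod_cast (by omega : 0 < n)
      have hnθ := (natCast_add_pos hα1 hθ (hs.trans hn)).ne'
      have e1 : (n : ℝ) ^ (α - r) = (n : ℝ) ^ α / (n : ℝ) ^ r := by
        rw [Real.rpow_sub hn0, Real.rpow_natCast]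
      have e2 : (n : ℝ) ^ (2 * (r : ℝ) - α - 1) = ((n : ℝ) ^ r) ^ 2 / (n : ℝ) ^ α / n := by
        rw [Real.rpow_sub_one hn0.ne', Real.rpow_sub hn0, mul_comm, Real.rpow_mul hn0.le,
          Real.rpow_natCast]
        norm_num
      have e3 : (n : ℝ) ^ (1 - α) = n / (n : ℝ) ^ α := by
        rw [Real.rpow_sub hn0, Real.rpow_one]
      rw [e1, e2, e3, Real.rpow_sub_one hn0.ne']
      have hp : (n : ℝ) ^ α ≠ 0 := (Real.rpow_pos_of_pos hn0 _).ne'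
      have hp' : (n : ℝ) ^ r ≠ 0 := pow_ne_zero _ hn0.ne'
      have hn0' := hn0.ne'
      field_simp))
  -- The factor `2r - α` in `incrVar` cancels the exponent produced by summation.
  have hlim : (Real.Gamma (s + (α + θ - r)) / Real.Gamma (s + θ)) ^ 2 * (incrVar α r * S ω)
        / (2 * (r : ℝ) - α)
      = sibuya α r * (rising ((r : ℝ) - α) r / (r.factorial : ℝ))
        * (Real.Gamma (s + (α + θ - r)) / Real.Gamma (s + θ)) ^ 2 * S ω := by
    rw [incrVar_eq hα0 hα1 hr, div_eq_iff hβ.ne']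
    ring
  rw [hlim] at h8
  refine h8.congr fun n => ?_
  rw [predQuadVarFrom]
  congr 1
  exact Finset.sum_congr rfl fun k hk => (h3 k (Finset.mem_Ico.1 hk).1).symm

end QuadraticVariation

lemma rising_eq_prod_Ico (x : ℝ) (n : ℕ) :
    rising (x + 1) (n - 1) = ∏ k ∈ Finset.Ico 1 n, ((k : ℝ) + x) := by
  rcases n with _ | n
  · simp [rising_zero]
  · rw [Nat.add_sub_cancel]
    induction n with
    | zero => simp [rising_zero]
    | succ n ih =>
      rw [rising_succ_right, ih, Finset.prod_Ico_succ_top (show 1 ≤ n + 1 by omega)]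
      push_cast
      ring

lemma weight_eq_prodRatio (α θ : ℝ) (r n : ℕ) :
    weight α θ r n = prodRatio θ (α + θ - r) 1 n := by
  rw [weight, rising_eq_prod_Ico, rising_eq_prod_Ico, prodRatio, Finset.prod_div_distrib]

lemma truncWeight_eq_prodRatio (α θ : ℝ) (r n : ℕ) :
    truncWeight α θ r n = prodRatio θ (α + θ - r) r n :=
  Finset.prod_congr rfl fun k _ => by ring

end EwensPitman

end

theorem mainTheorem6 {Ω : Type*} {mΩ : MeasurableSpace Ω} (μ : Measure Ω) [IsProbabilityMeasure μ]
    (α θ : ℝ) (hα0 : 0 < α) (hα1 : α < 1) (hθ : 0 < α + θ)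
    (P : (n : ℕ) → Ω → Finpartition (Finset.Icc 1 n))
    (hP : EwensPitman.IsEwensPitmanProcess μ α θ P) :
    ∃ S : Ω → ℝ, Measurable S ∧ (∀ᵐ ω ∂μ, 0 < S ω) ∧
      (∀ᵐ ω ∂μ, Tendsto (fun n : ℕ => (EwensPitman.numBlocks P n ω : ℝ) / (n : ℝ) ^ α)
        atTop (𝓝 (S ω))) ∧
      ∀ r : ℕ, 1 ≤ r →
        ((∀ m : ℕ, 1 ≤ m → m < r → α + θ ≠ (m : ℝ)) →
          EwensPitman.IsSquareIntegrableMartingaleFrom 1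
            (EwensPitman.weightedProcess α θ P r (EwensPitman.weight α θ r))
            (EwensPitman.blockFiltration hP.measurableSet_eq r) μ ∧
          ∀ᵐ ω ∂μ, Tendsto
            (fun n : ℕ => EwensPitman.predQuadVarFrom 1
              (EwensPitman.weightedProcess α θ P r (EwensPitman.weight α θ r))
              (EwensPitman.blockFiltration hP.measurableSet_eq r) μ n ω
                / (n : ℝ) ^ (2 * (r : ℝ) - α))
            atTop
            (𝓝 (EwensPitman.sibuya α r * (EwensPitman.rising ((r : ℝ) - α) r / (r.factorial : ℝ))
              * (Real.Gamma (α + θ - (r : ℝ) + 1) / Real.Gamma (θ + 1)) ^ 2 * S ω))) ∧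
        (EwensPitman.IsSquareIntegrableMartingaleFrom r
            (EwensPitman.weightedProcess α θ P r (EwensPitman.truncWeight α θ r))
            (EwensPitman.blockFiltration hP.measurableSet_eq r) μ ∧
          ∀ᵐ ω ∂μ, Tendsto
            (fun n : ℕ => EwensPitman.predQuadVarFrom r
              (EwensPitman.weightedProcess α θ P r (EwensPitman.truncWeight α θ r))
              (EwensPitman.blockFiltration hP.measurableSet_eq r) μ n ω
                / (n : ℝ) ^ (2 * (r : ℝ) - α))
            atTop
            (𝓝 (EwensPitman.sibuya α r * (EwensPitman.rising ((r : ℝ) - α) r / (r.factorial : ℝ))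
              * (Real.Gamma (α + θ) / Real.Gamma ((r : ℝ) + θ)) ^ 2 * S ω))) := by
  obtain ⟨S, hSm, hS⟩ := EwensPitman.exists_ae_tendsto_numBlocks hα0 hα1 hθ hP
  refine ⟨S, hSm, EwensPitman.ae_pos_of_tendsto_numBlocks hα0 hα1 hθ hP hS, hS,
    fun r hr => ⟨fun hne => ?_, ?_⟩⟩
  -- A zero denominator at `k` means `α + θ = r - k`; positivity of `α + θ` forces `k < r`, so this
  -- is an excluded value.
  · have hb : ∀ k : ℕ, 1 ≤ k → (k : ℝ) + (α + θ - r) ≠ 0 := fun k hk h0 => by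
      have h1 : (k : ℝ) < r := by linarith
      have h2 : k < r := by exact_mod_cast h1
      refine hne (r - k) (by omega) (by omega) ?_
      rw [Nat.cast_sub h2.le]
      linarith
    have hw : ∀ n : ℕ, 1 ≤ n → EwensPitman.weight α θ r n
        = EwensPitman.prodRatio θ (α + θ - r) 1 n :=
      fun n _ => EwensPitman.weight_eq_prodRatio α θ r n
    refine ⟨EwensPitman.isSquareIntegrableMartingaleFrom_weightedProcess hα0 hα1 hθ hP hr le_rfl
      fun n hn => EwensPitman.weight_step hα1 hθ le_rfl hb hw hn, ?_⟩
    have h := EwensPitman.ae_tendsto_predQuadVarFrom hα0 hα1 hθ hP hr le_rfl hb hw hS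
    rwa [show ((1 : ℕ) : ℝ) + (α + θ - r) = α + θ - r + 1 by push_cast; ring,
      show ((1 : ℕ) : ℝ) + θ = θ + 1 by push_cast; ring] at h
  -- Starting at `r`, every denominator is at least `α + θ > 0`, so no value has to be excluded.
  · have hb : ∀ k : ℕ, r ≤ k → (k : ℝ) + (α + θ - r) ≠ 0 := fun k hk h0 => by
      have h1 : (r : ℝ) ≤ k := by exact_mod_cast hk
      linarith
    have hw : ∀ n : ℕ, r ≤ n → EwensPitman.truncWeight α θ r n
        = EwensPitman.prodRatio θ (α + θ - r) r n :=
      fun n _ => EwensPitman.truncWeight_eq_prodRatio α θ r n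
    refine ⟨EwensPitman.isSquareIntegrableMartingaleFrom_weightedProcess hα0 hα1 hθ hP hr hr
      fun n hn => EwensPitman.weight_step hα1 hθ hr hb hw hn, ?_⟩
    have h := EwensPitman.ae_tendsto_predQuadVarFrom hα0 hα1 hθ hP hr hr hb hw hS
    rwa [show (r : ℝ) + (α + θ - r) = α + θ by ring] at h
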